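/- Let $\varphi$ be an Orlicz N-function (continuous, even, convex, $\varphi(0)=0$, $\varphi(x)>0$ for $x\ne0$, $\varphi(x)/x\to0$ as $x\to0$, $\varphi(x)/x\to\infty$ as $x\to\infty$) with $\liminf_{x\to0}\varphi(x)/x^2>0$; let $\varphi^*(x)=\sup_{z\in\mathbb R}(xz-\varphi(z))$, let $\varphi^{(-1)}$ be the inverse of $\varphi$ on $[0,\infty)$, and $\Psi(v)=v/\varphi^{(-1)}(v)$ for $v>0$, $\Psi(0)=0$. On a probability space, $\mathrm{Sub}_\varphi(\Omega)$ is the set of random variables $\zeta$ with $E\zeta=0$ for which there is $r>0$ with $E e^{\lambda\zeta}\le e^{\varphi(r\lambda)}$ for all $\lambda\in\mathbb R$, and $\tau_\varphi(\zeta)$ is the infimum of such $r$. Let $y=\{y(\lambda),\lambda\in\mathbb R\}$ be a strictly $\varphi$-sub-Gaussian process with determining constant $C_y\ge0$: each $y(\lambda)$ is in $\mathrm{Sub}_\varphi(\Omega)$, and every countable (finite, or mean-square convergent) linear combination $S$ of the $y(\lambda)$ is in $\mathrm{Sub}_\varphi(\Omega)$ with $\tau_\varphi(S)\le C_y(ES^2)^{1/2}$.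 Assume that $\Gamma_y(\lambda,\mu)=E\,y(\lambda)y(\mu)$ has finite variation on $\mathbb R^2$, i.e. $\int_{\mathbb R}\int_{\mathbb R} d|\Gamma_y|<\infty$; here $\int\!\int g\,d|\Gamma_y|$ is, for continuous $g\ge0$, the limit under refinement of the sums $\sum\sum g\,|\Delta_i\Delta_j\Gamma_y|$ over finite grids. Let $Z$ be admissible for $\mathrm{Sub}_\varphi(\Omega)$ with constant $u_0\ge0$: $Z:[0,\infty)\to\mathbb R$ is continuous, strictly increasing and unbounded, $Z(u)>0$ and $u/Z(u)$ is non-decreasing for $u>u_0$, and $\int_0^\varepsilon\Psi\big(\ln(Z^{(-1)}(1/s)-u_0)\big)\,ds$ converges for some $\varepsilon>0$. Let $a_1,\dots,a_N\in\mathbb R$, let $\kappa=\cos$ or $\kappa=\sin$, and put $$I(t,x,\lambda)=\kappa\Big(\lambda x+t\,p(\lambda)\Big),\qquad p(\lambda)=\sum_{k=1}^N a_k\lambda^{2k+1}(-1)^k .$$ Let $a\le b$, $c\le d$, $\varkappa=\max(b-a,d-c)>0$. Assume that for $a\le t\le b$, $c\le x\le d$ the mean-square Stieltjes integral $$U(t,x)=\int_{-\infty}^{\infty}I(t,x,\lambda)\,dy(\lambda)$$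 exists, that $U$ is almost surely continuous on $[a,b]\times[c,d]$, and that, with $W(\lambda)=Z\big(\tfrac{|\lambda|}2+u_0\big)+Z\big(\tfrac12|p(\lambda)|+u_0\big)$, $$C_Z^2=\int_{\mathbb R}\int_{\mathbb R}W(\lambda)W(\mu)\,d|\Gamma_y(\lambda,\mu)|<\infty .$$ Put $$\Gamma=C_y\Big(\int_{\mathbb R}\int_{\mathbb R}d|\Gamma_y(\lambda,\mu)|\Big)^{1/2},\qquad \gamma_0=\frac{2C_yC_Z}{Z(1/\varkappa+u_0)},$$ $$\hat I_\varphi(\delta)=\int_0^\delta\Psi\Big(\ln\Big[\Big(\tfrac{b-a}2\big(Z^{(-1)}(\tfrac{2C_ZC_y}s)-u_0\big)+1\Big)\Big(\tfrac{d-c}2\big(Z^{(-1)}(\tfrac{2C_ZC_y}s)-u_0\big)+1\Big)\Big]\Big)ds .$$ Then for every $0<\theta<1$ the integral $\hat I_\varphi(\min(\theta\Gamma,\gamma_0))$ is finite, and for every $$u>\frac{2\,\hat I_\varphi(\min(\theta\Gamma,\gamma_0))}{\theta(1-\theta)}$$ one has $$P\Big\{\sup_{a\le t\le b,\ c\le x\le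 d}|U(t,x)|>u\Big\}\le 2\exp\Big\{-\varphi^*\Big(\frac1\Gamma\Big(u(1-\theta)-\frac2\theta\,\hat I_\varphi(\min(\theta\Gamma,\gamma_0))\Big)\Big)\Big\}.$$ (If $\Gamma=0$, so that $U=0$ almost surely, the right-hand side is read as $2$.) -/

import Mathlib

open MeasureTheory ProbabilityTheory Filter Topology
open scoped ENNReal

namespace PhiSubGaussian

/-! ### Orlicz N-functions, inverses and conjugates -/

/-- Orlicz N-function: a continuous even convex function with `φ 0 = 0`, `φ x > 0` for `x ≠ 0`,
`φ x / x → 0` as `x → 0` and `φ x / x → ∞` as `x → ∞`. -/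
structure IsNFunction (φ : ℝ → ℝ) : Prop where
  continuous : Continuous φ
  even : ∀ x, φ (-x) = φ x
  convex : ConvexOn ℝ Set.univ φ
  map_zero : φ 0 = 0
  pos : ∀ x, x ≠ 0 → 0 < φ x
  tendsto_zero : Tendsto (fun x => φ x / x) (𝓝[≠] 0) (𝓝 0)
  tendsto_atTop : Tendsto (fun x => φ x / x) atTop atTop

/-- Condition Q: `liminf_{x → 0} φ(x) / x² > 0`, the value `∞` being allowed. -/
def ConditionQ (φ : ℝ → ℝ) : Prop :=
  (0 : EReal) < liminf (fun x : ℝ => ((φ x / x ^ 2 : ℝ) : EReal)) (𝓝[≠] 0)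

/-- The inverse `f^{(-1)}` of a function that is strictly increasing on `[0, ∞)`: for `v` in
`f([0, ∞))` it is the unique `u ≥ 0` with `f u = v`. -/
noncomputable def inverse (f : ℝ → ℝ) : ℝ → ℝ :=
  Function.invFunOn f (Set.Ici 0)

/-- Young-Fenchel transform `φ*(x) = sup_y (x y - φ(y))`; the supremum is finite for N-functions. -/
noncomputable def youngFenchel (φ : ℝ → ℝ) (x : ℝ) : ℝ :=
  ⨆ z : ℝ, (x * z - φ z)

/-- `Ψ(v) = v / φ^{(-1)}(v)`. -/
noncomputable def Psi (φ : ℝ → ℝ) (v : ℝ) : ℝ :=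
  v / inverse φ v

/-! ### `φ`-sub-Gaussian random variables and processes -/

variable {Ω : Type*} [MeasurableSpace Ω]

/-- `ζ` belongs to `Sub_φ(Ω)`. -/
structure MemSub (φ : ℝ → ℝ) (P : Measure Ω) (ζ : Ω → ℝ) : Prop where
  integrable : Integrable ζ P
  mean_zero : ∫ ω, ζ ω ∂P = 0
  exp_integrable : ∀ l : ℝ, Integrable (fun ω => Real.exp (l * ζ ω)) P
  exists_bound : ∃ r : ℝ, 0 < r ∧ ∀ l : ℝ, ∫ ω, Real.exp (l * ζ ω) ∂P ≤ Real.exp (φ (l * r))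

/-- The `φ`-sub-Gaussian standard `τ_φ(ζ)` of an element `ζ` of `Sub_φ(Ω)`. -/
noncomputable def tau (φ : ℝ → ℝ) (P : Measure Ω) (ζ : Ω → ℝ) : ℝ :=
  sInf {r : ℝ | 0 < r ∧ ∀ l : ℝ, ∫ ω, Real.exp (l * ζ ω) ∂P ≤ Real.exp (φ (r * l))}

/-- The process `X` is strictly `φ`-sub-Gaussian with determining constant `C`: its values lie in
`Sub_φ(Ω)`, and every countable linear combination `S = ∑ cᵢ X(tᵢ)` (finite, or convergent in mean
square) lies in `Sub_φ(Ω)` and satisfies `τ_φ(S) ≤ C (E S²)^{1/2}`. Finite combinations are those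
with `cᵢ = 0` for large `i`. -/
structure IsStrictlySub {T : Type*} (φ : ℝ → ℝ) (P : Measure Ω) (X : T → Ω → ℝ) (C : ℝ) :
    Prop where
  memSub : ∀ t, MemSub φ P (X t)
  const_nonneg : 0 ≤ C
  tau_le : ∀ (t : ℕ → T) (c : ℕ → ℝ) (S : Ω → ℝ), MemLp S 2 P →
    Tendsto (fun n : ℕ => eLpNorm (fun ω => (∑ i ∈ Finset.range n, c i * X (t i) ω) - S ω) 2 P)
      atTop (𝓝 0) →
    MemSub φ P S ∧ tau φ P S ≤ C * Real.sqrt (∫ ω, S ω ^ 2 ∂P)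

/-- `Z` (on `[0, ∞)`, with the constant `u₀`) is admissible for `Sub_φ(Ω)`. Unboundedness of `Z` is
what makes `Z^{(-1)}(1/s)` meaningful for all small `s > 0`. -/
structure IsAdmissible (φ Z : ℝ → ℝ) (u₀ : ℝ) : Prop where
  const_nonneg : 0 ≤ u₀
  continuousOn : ContinuousOn Z (Set.Ici 0)
  strictMonoOn : StrictMonoOn Z (Set.Ici 0)
  tendsto_atTop : Tendsto Z atTop atTop
  pos : ∀ u, u₀ < u → 0 < Z u
  monotoneOn_div : MonotoneOn (fun u => u / Z u) (Set.Ioi u₀)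
  integrable : ∃ ε : ℝ, 0 < ε ∧
    IntegrableOn (fun s => Psi φ (Real.log (inverse Z (1 / s) - u₀))) (Set.Ioo 0 ε)

/-! ### Stieltjes integrals -/

/-- The (uncentred) covariance function `Γ_y(s, t) = E y(s) y(t)`. -/
noncomputable def covFun (P : Measure Ω) (y : ℝ → Ω → ℝ) (s t : ℝ) : ℝ :=
  ∫ ω, y s ω * y t ω ∂P

/-- The double increment of `G` over `[s, s'] × [t, t']`. -/
def rectIncrement (G : ℝ → ℝ → ℝ) (s s' t t' : ℝ) : ℝ :=
  G s' t' - G s t' - G s' t + G s t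

/-- The Stieltjes integral `∫∫ g(u,v) d|G(u,v)|` over the plane of a continuous `g ≥ 0` against the
variation of `G`: the limit under refinement of the sums `∑∑ g |Δᵢ Δⱼ G|`, written as the supremum
over all finite grids of the lower sums (these increase under refinement). -/
noncomputable def varIntegral (G : ℝ → ℝ → ℝ) (g : ℝ → ℝ → ℝ≥0∞) : ℝ≥0∞ :=
  ⨆ (n : ℕ) (m : ℕ) (p : ℕ → ℝ) (q : ℕ → ℝ) (_ : Monotone p) (_ : Monotone q),
    ∑ i ∈ Finset.range n, ∑ j ∈ Finset.range m,
      (⨅ u ∈ Set.Icc (p i) (p (i + 1)), ⨅ v ∈ Set.Icc (q j) (q (j + 1)), g u v) *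
        ‖rectIncrement G (p i) (p (i + 1)) (q j) (q (j + 1))‖ₑ

/-- Total variation `∫∫ d|G(u,v)|` of `G` on the plane: the supremum over all finite grids of
`∑∑ |Δᵢ Δⱼ G|`. -/
noncomputable def totalVariation (G : ℝ → ℝ → ℝ) : ℝ≥0∞ :=
  varIntegral G (fun _ _ => 1)

/-- `p 0 ≤ p 1 ≤ ⋯ ≤ p n` is a partition of `[A, B]` of mesh less than `δ`, with tags
`τ i ∈ [p i, p (i+1)]`. -/
structure IsTaggedPartition (A B δ : ℝ) (n : ℕ) (p τ : ℕ → ℝ) : Prop where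
  left : p 0 = A
  right : p n = B
  le : ∀ i < n, p i ≤ p (i + 1)
  mesh : ∀ i < n, p (i + 1) - p i < δ
  tag : ∀ i < n, τ i ∈ Set.Icc (p i) (p (i + 1))

/-- `J = ∫_A^B f(l) dy(l)` in mean square: `J` is the limit in `L²` of the Riemann-Stieltjes sums
`∑ f(τᵢ) (y(pᵢ₊₁) - y(pᵢ))` as the mesh tends to `0`. -/
def HasMSIntegralOn (P : Measure Ω) (y : ℝ → Ω → ℝ) (f : ℝ → ℝ) (A B : ℝ) (J : Ω → ℝ) : Prop :=
  MemLp J 2 P ∧ ∀ ε : ℝ≥0∞, 0 < ε → ∃ δ : ℝ, 0 < δ ∧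
    ∀ (n : ℕ) (p τ : ℕ → ℝ), IsTaggedPartition A B δ n p τ →
      eLpNorm (fun ω => (∑ i ∈ Finset.range n, f (τ i) * (y (p (i + 1)) ω - y (p i) ω)) - J ω) 2 P
        ≤ ε

/-- `X = ∫_{-∞}^{∞} f(l) dy(l)` in mean square: `X` is the limit in `L²` of the integrals over
`[A, B]` as `A → -∞` and `B → ∞`. -/
def HasMSIntegral (P : Measure Ω) (y : ℝ → Ω → ℝ) (f : ℝ → ℝ) (X : Ω → ℝ) : Prop :=
  MemLp X 2 P ∧ ∃ J : ℝ → ℝ → Ω → ℝ,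
    (∀ A B, A ≤ B → HasMSIntegralOn P y f A B (J A B)) ∧
    Tendsto (fun r : ℝ × ℝ => eLpNorm (fun ω => J r.1 r.2 ω - X ω) 2 P) (atBot ×ˢ atTop) (𝓝 0)

/-! ### The odd-order equation and the quantities in the bound -/

/-- `∑_{k=1}^N α_k l^{2k+1} (-1)^k`. -/
def oddSymbol (N : ℕ) (α : ℕ → ℝ) (l : ℝ) : ℝ :=
  ∑ k ∈ Finset.Icc 1 N, α k * l ^ (2 * k + 1) * (-1) ^ k

/-- `I(t, x, l) = κ(l x + t ∑_{k=1}^N α_k l^{2k+1} (-1)^k)`. -/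
def waveKernel (κ : ℝ → ℝ) (N : ℕ) (α : ℕ → ℝ) (t x l : ℝ) : ℝ :=
  κ (l * x + t * oddSymbol N α l)

/-- `Z(|l|/2 + u₀) + Z(½ |∑_{k=1}^N α_k l^{2k+1} (-1)^k| + u₀)`. -/
noncomputable def weight (Z : ℝ → ℝ) (u₀ : ℝ) (N : ℕ) (α : ℕ → ℝ) (l : ℝ) : ℝ :=
  Z (|l| / 2 + u₀) + Z (1 / 2 * |oddSymbol N α l| + u₀)

/-- The integral `C_Z²`, with values in `[0, ∞]`. -/
noncomputable def CZsq (Z : ℝ → ℝ) (u₀ : ℝ) (N : ℕ) (α : ℕ → ℝ) (G : ℝ → ℝ → ℝ) : ℝ≥0∞ :=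
  varIntegral G (fun l m => ENNReal.ofReal (weight Z u₀ N α l * weight Z u₀ N α m))

/-- The constant `C_Z`, when the integral `C_Z²` converges. -/
noncomputable def CZ (Z : ℝ → ℝ) (u₀ : ℝ) (N : ℕ) (α : ℕ → ℝ) (G : ℝ → ℝ → ℝ) : ℝ :=
  Real.sqrt (CZsq Z u₀ N α G).toReal

/-- The constant `Γ = C_y (∫∫ d|G|)^{1/2}`, when `G` has finite variation. -/
noncomputable def bigGamma (Cy : ℝ) (G : ℝ → ℝ → ℝ) : ℝ :=
  Cy * Real.sqrt (totalVariation G).toReal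

/-- `γ₀ = 2 C_y C_Z / Z(1/ϰ + u₀)` with `ϰ = max(b - a, d - c)`; here `K = C_y C_Z`. -/
noncomputable def gammaZero (Z : ℝ → ℝ) (u₀ K a b c d : ℝ) : ℝ :=
  2 * K / Z (1 / max (b - a) (d - c) + u₀)

/-- The integrand of `Î_φ`; here `K = C_y C_Z`. -/
noncomputable def entropyIntegrand (φ Z : ℝ → ℝ) (u₀ K a b c d s : ℝ) : ℝ :=
  Psi φ (Real.log
    (((b - a) / 2 * (inverse Z (2 * K / s) - u₀) + 1) *
      ((d - c) / 2 * (inverse Z (2 * K / s) - u₀) + 1)))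

/-- `Î_φ(δ)`; here `K = C_y C_Z`. -/
noncomputable def entropyIntegral (φ Z : ℝ → ℝ) (u₀ K a b c d δ : ℝ) : ℝ :=
  ∫ s in (0 : ℝ)..δ, entropyIntegrand φ Z u₀ K a b c d s

end PhiSubGaussian

open PhiSubGaussian

/-!
The bound is the Orlicz-space form of Dudley's chaining argument, and everything about the equation
enters through two estimates in the `φ`-sub-Gaussian standard.

* *Second moments.* The expectation of the square of a Riemann-Stieltjes sum of `f` against `dy` is
  a double sum `∑∑ f(τᵢ) f(τⱼ) ΔᵢΔⱼΓ_y`. If `|f| ≤ c w` with `w` continuous, this is at most `c²`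
  times a tagged sum for `∫∫ w ⊗ w d|Γ_y|`, which on a fine grid exceeds the lower sum by at most a
  small multiple of the (finite) total variation. Hence `(E X²)^{1/2} ≤ c (∫∫ w ⊗ w d|Γ_y|)^{1/2}`
  for `X = ∫ f dy` (`HasMSIntegral.toReal_eLpNorm_le`).
* *Exponential moments.* `X` is a mean-square limit of finite linear combinations of the process, so
  `E e^{lX} ≤ e^{φ(l C_y ‖X‖₂)}` by Fatou's lemma (`IsStrictlySub.lintegral_exp_le`).

With `w = 1` this gives the standard `Γ` for the values of `U`. Since `u / Z(u)` is non-decreasing,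
`|sin(q r / 2)| ≤ Z(|q|/2 + u₀) / Z(1/h + u₀)` for `|r| ≤ h`, and so `w = weight` and
`c = 2 / Z(1/h + u₀)` give the standard `2 C_y C_Z / Z(1/h + u₀)` for the increments of `U` between
points at sup-distance at most `h`.

In the chaining (`measure_exists_lt_abs_le`) the net `V k` has the radius at which increments have
standard at most `Γ θ^{k+1}`, and a single point once that level is at least `γ₀`; its cardinality
is at most `exp H_k`. A value on a net is a sum of links of standard at most `σ_k = Γ θ^k`. Hölder's
inequality with the weights `l σ_k / max(x, φ⁻¹(H_k))`, where `x = l Γ / (1 - θ)`, bounds the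
exponential moment of the supremum over the nets by `2 exp(φ(x) + 2 l ∑ σ_k Ψ(H_k))`; the sum is
at most `Î_φ / (θ (1 - θ))` because the integrand of `Î_φ` is non-increasing
(`sum_psi_netEntropy_le`). Markov's inequality and the infimum over `x` produce `φ*`, and continuity
of `U` passes from the nets to the rectangle.
-/

namespace PhiSubGaussian

/-! ### Inverses of increasing functions -/

section Inverse

variable {f : ℝ → ℝ}

theorem inverse_spec (hc : ContinuousOn f (Set.Ici 0)) (ht : Tendsto f atTop atTop) {v : ℝ}
    (hv : f 0 ≤ v) : 0 ≤ inverse f v ∧ f (inverse f v) = v := by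
  obtain ⟨M, hM0, hM⟩ := ((eventually_ge_atTop (0 : ℝ)).and (ht.eventually_ge_atTop v)).exists
  obtain ⟨x, hx, hxv⟩ := intermediate_value_Icc hM0 (hc.mono Set.Icc_subset_Ici_self) ⟨hv, hM⟩
  have h : ∃ a ∈ Set.Ici (0 : ℝ), f a = v := ⟨x, hx.1, hxv⟩
  exact ⟨Function.invFunOn_mem h, Function.invFunOn_eq h⟩

theorem inverse_le_inverse (hc : ContinuousOn f (Set.Ici 0)) (hm : StrictMonoOn f (Set.Ici 0))
    (ht : Tendsto f atTop atTop) {v w : ℝ} (hv : f 0 ≤ v) (hvw : v ≤ w) :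
    inverse f v ≤ inverse f w := by
  obtain ⟨h1, h2⟩ := inverse_spec hc ht hv
  obtain ⟨h3, h4⟩ := inverse_spec hc ht (hv.trans hvw)
  rw [← hm.le_iff_le h1 h3, h2, h4]
  exact hvw

theorem le_inverse (hc : ContinuousOn f (Set.Ici 0)) (hm : StrictMonoOn f (Set.Ici 0))
    (ht : Tendsto f atTop atTop) {x v : ℝ} (hx : 0 ≤ x) (hv : f x ≤ v) : x ≤ inverse f v := by
  have h0 : f 0 ≤ v := ((hm.le_iff_le Set.self_mem_Ici hx).2 hx).trans hv
  obtain ⟨h1, h2⟩ := inverse_spec hc ht h0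
  rw [← hm.le_iff_le hx h1, h2]
  exact hv

end Inverse

/-! ### N-functions and `Ψ` -/

namespace IsNFunction

variable {φ : ℝ → ℝ}

theorem nonneg (hφ : IsNFunction φ) (x : ℝ) : 0 ≤ φ x := by
  rcases eq_or_ne x 0 with rfl | h
  · exact hφ.map_zero.ge
  · exact (hφ.pos x h).le

theorem map_mul_le (hφ : IsNFunction φ) {t : ℝ} (h0 : 0 ≤ t) (h1 : t ≤ 1) (y : ℝ) :
    φ (t * y) ≤ t * φ y := by
  have := hφ.convex.2 (Set.mem_univ y) (Set.mem_univ 0) h0 (sub_nonneg.2 h1) (by ring)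
  simpa [hφ.map_zero] using this

theorem map_le_div_mul (hφ : IsNFunction φ) {x y : ℝ} (hx : 0 ≤ x) (hxy : x ≤ y) (hy : 0 < y) :
    φ x ≤ x / y * φ y := by
  have := hφ.map_mul_le (div_nonneg hx hy.le) ((div_le_one hy).2 hxy) y
  rwa [div_mul_cancel₀ _ hy.ne'] at this

theorem strictMonoOn (hφ : IsNFunction φ) : StrictMonoOn φ (Set.Ici 0) := by
  intro x hx y _ hxy
  have hx : 0 ≤ x := hx
  have hy : 0 < y := hx.trans_lt hxy
  refine (hφ.map_le_div_mul hx hxy.le hy).trans_lt ?_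
  have := hφ.pos y hy.ne'
  have h : x / y < 1 := (div_lt_one hy).2 hxy
  nlinarith

theorem div_le_div (hφ : IsNFunction φ) {x y : ℝ} (hx : 0 < x) (hxy : x ≤ y) :
    φ x / x ≤ φ y / y := by
  have hy := hx.trans_le hxy
  rw [div_le_iff₀ hx]
  calc φ x ≤ x / y * φ y := hφ.map_le_div_mul hx.le hxy hy
    _ = φ y / y * x := by ring

theorem tendsto_self (hφ : IsNFunction φ) : Tendsto φ atTop atTop := by
  have := hφ.tendsto_atTop.atTop_mul_atTop₀ tendsto_id
  refine this.congr' ?_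
  filter_upwards [eventually_gt_atTop 0] with x hx
  simp [div_mul_cancel₀ _ hx.ne']

theorem map_abs (hφ : IsNFunction φ) (x : ℝ) : φ |x| = φ x := by
  rcases abs_choice x with h | h <;> simp [h, hφ.even]

theorem le_of_abs_le_abs (hφ : IsNFunction φ) {x y : ℝ} (h : |x| ≤ |y|) : φ x ≤ φ y := by
  rw [← hφ.map_abs x, ← hφ.map_abs y]
  exact hφ.strictMonoOn.monotoneOn (abs_nonneg x) (abs_nonneg y) h

theorem inverse_spec (hφ : IsNFunction φ) {v : ℝ} (hv : 0 ≤ v) :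
    0 ≤ inverse φ v ∧ φ (inverse φ v) = v :=
  PhiSubGaussian.inverse_spec hφ.continuous.continuousOn hφ.tendsto_self
    (by rw [hφ.map_zero]; exact hv)

theorem inverse_mono (hφ : IsNFunction φ) {v w : ℝ} (hv : 0 ≤ v) (hvw : v ≤ w) :
    inverse φ v ≤ inverse φ w :=
  inverse_le_inverse hφ.continuous.continuousOn hφ.strictMonoOn hφ.tendsto_self
    (by rw [hφ.map_zero]; exact hv) hvw

theorem inverse_pos (hφ : IsNFunction φ) {v : ℝ} (hv : 0 < v) : 0 < inverse φ v := by
  obtain ⟨h1, h2⟩ := hφ.inverse_spec hv.le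
  refine h1.lt_of_ne fun h => ?_
  rw [← h, hφ.map_zero] at h2
  exact hv.ne h2

theorem psi_nonneg (hφ : IsNFunction φ) {v : ℝ} (hv : 0 ≤ v) : 0 ≤ Psi φ v :=
  div_nonneg hv (hφ.inverse_spec hv).1

theorem psi_mono (hφ : IsNFunction φ) {v w : ℝ} (hv : 0 ≤ v) (hvw : v ≤ w) :
    Psi φ v ≤ Psi φ w := by
  rcases hv.eq_or_lt with rfl | h
  · simpa [Psi] using hφ.psi_nonneg hvw
  · have := hφ.div_le_div (hφ.inverse_pos h) (hφ.inverse_mono hv hvw)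
    rwa [(hφ.inverse_spec hv).2, (hφ.inverse_spec (hv.trans hvw)).2] at this

theorem psi_mul_le (hφ : IsNFunction φ) {c v : ℝ} (hc : 1 ≤ c) (hv : 0 ≤ v) :
    Psi φ (c * v) ≤ c * Psi φ v := by
  rcases hv.eq_or_lt with rfl | h
  · simp [Psi]
  · have h1 := hφ.inverse_mono hv (le_mul_of_one_le_left hv hc)
    have h2 := hφ.inverse_pos h
    rw [Psi, Psi, ← mul_div_assoc]
    exact div_le_div_of_nonneg_left (by positivity) h2 h1

/-- The choice of Hölder exponents in the chaining argument: replacing `x` by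
`max x (φ⁻¹ H)` pays for the entropy `H` at the price `2 Ψ(H)`. -/
theorem add_div_max_le (hφ : IsNFunction φ) {x H : ℝ} (hx : 0 < x) (hH : 0 ≤ H) :
    (H + φ (max x (inverse φ H))) / max x (inverse φ H) ≤ 2 * Psi φ H + φ x / x := by
  have hΨ := hφ.psi_nonneg hH
  rcases le_total (inverse φ H) x with h | h
  · rw [max_eq_left h, add_div]
    have : H / x ≤ Psi φ H := by
      rcases hH.eq_or_lt with rfl | h'
      · simpa using hΨ
      · exact div_le_div_of_nonneg_left hH (hφ.inverse_pos h') h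
    linarith
  · rw [max_eq_right h, (hφ.inverse_spec hH).2, add_div]
    have : 0 ≤ φ x / x := div_nonneg (hφ.nonneg x) hx.le
    change Psi φ H + Psi φ H ≤ _
    linarith

theorem youngFenchel_zero (hφ : IsNFunction φ) : youngFenchel φ 0 = 0 := by
  have hle : ∀ z : ℝ, 0 * z - φ z ≤ 0 := fun z => by simpa using hφ.nonneg z
  refine le_antisymm (ciSup_le hle) ?_
  refine (le_ciSup (f := fun z : ℝ => 0 * z - φ z) ⟨0, ?_⟩ 0).trans' (by simp [hφ.map_zero])
  rintro _ ⟨z, rfl⟩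
  exact hle z

end IsNFunction

/-! ### Admissible functions and the kernel -/

namespace IsAdmissible

variable {φ Z : ℝ → ℝ} {u₀ : ℝ}

theorem inverse_spec (hZ : IsAdmissible φ Z u₀) {v : ℝ} (hv : Z 0 ≤ v) :
    0 ≤ inverse Z v ∧ Z (inverse Z v) = v :=
  PhiSubGaussian.inverse_spec hZ.continuousOn hZ.tendsto_atTop hv

theorem le_inverse (hZ : IsAdmissible φ Z u₀) {x v : ℝ} (hx : 0 ≤ x) (hv : Z x ≤ v) :
    x ≤ inverse Z v :=
  PhiSubGaussian.le_inverse hZ.continuousOn hZ.strictMonoOn hZ.tendsto_atTop hx hv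

theorem mono (hZ : IsAdmissible φ Z u₀) {x y : ℝ} (hx : 0 ≤ x) (h : x ≤ y) : Z x ≤ Z y :=
  hZ.strictMonoOn.monotoneOn hx (hx.trans h) h

theorem nonneg_const (hZ : IsAdmissible φ Z u₀) : 0 ≤ Z u₀ := by
  have h0 := hZ.const_nonneg
  have hc : ContinuousWithinAt Z (Set.Ioi u₀) u₀ :=
    (hZ.continuousOn u₀ h0).mono fun x hx => h0.trans (le_of_lt hx)
  exact ge_of_tendsto hc (eventually_nhdsWithin_of_forall fun x hx => (hZ.pos x hx).le)

theorem nonneg_add (hZ : IsAdmissible φ Z u₀) {A : ℝ} (hA : 0 ≤ A) : 0 ≤ Z (A + u₀) :=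
  hZ.nonneg_const.trans (hZ.mono hZ.const_nonneg (by linarith))

/-- Monotonicity of `Z` and of `u / Z(u)` combined: `A / B` or `1`, whichever is smaller, is at most
the quotient of the values of `Z`. -/
theorem min_le_div (hZ : IsAdmissible φ Z u₀) {A B : ℝ} (hA : 0 ≤ A) (hB : 0 < B) :
    min 1 (A / B) ≤ Z (A + u₀) / Z (B + u₀) := by
  have h0 := hZ.const_nonneg
  have hZB : 0 < Z (B + u₀) := hZ.pos _ (by linarith)
  rcases le_total B A with h | h
  · refine (min_le_left _ _).trans ((one_le_div hZB).2 (hZ.mono (by linarith) (by linarith)))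
  · refine (min_le_right _ _).trans ?_
    rcases hA.eq_or_lt with rfl | hA'
    · simpa using div_nonneg hZ.nonneg_const hZB.le
    · have hZA : 0 < Z (A + u₀) := hZ.pos _ (by linarith)
      have := hZ.monotoneOn_div (show A + u₀ ∈ Set.Ioi u₀ by simpa)
        (show B + u₀ ∈ Set.Ioi u₀ by simpa) (by linarith)
      simp only at this
      rw [div_le_div_iff₀ hZA hZB] at this
      rw [div_le_div_iff₀ hB hZB]
      have h3 : Z (A + u₀) ≥ 0 := hZA.le
      -- `A / B ≤ (A + u₀) / (B + u₀)` since `A ≤ B`.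
      have h4 : A * (B + u₀) ≤ (A + u₀) * B := by nlinarith
      have h5 : 0 < B + u₀ := by linarith
      have h6 : (A * Z (B + u₀)) * (B + u₀) ≤ (Z (A + u₀) * B) * (B + u₀) := by
        calc (A * Z (B + u₀)) * (B + u₀) = (A * (B + u₀)) * Z (B + u₀) := by ring
          _ ≤ ((A + u₀) * B) * Z (B + u₀) := by gcongr
          _ = ((A + u₀) * Z (B + u₀)) * B := by ring
          _ ≤ ((B + u₀) * Z (A + u₀)) * B := by gcongr
          _ = _ := by ring
      exact le_of_mul_le_mul_right h6 h5

/-- The inequality that makes `Z` a modulus of continuity for trigonometric kernels. -/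
theorem two_mul_min_le (hZ : IsAdmissible φ Z u₀) {q r h : ℝ} (hh : 0 < h) (hr : |r| ≤ h) :
    min 2 |q * r| ≤ 2 * (Z (1 / 2 * |q| + u₀) / Z (1 / h + u₀)) := by
  have h1 := hZ.min_le_div (A := 1 / 2 * |q|) (by positivity) (one_div_pos.2 hh)
  refine le_trans ?_ (mul_le_mul_of_nonneg_left h1 zero_le_two)
  rw [mul_min_of_nonneg _ _ zero_le_two, mul_one]
  refine min_le_min_left _ ?_
  rw [abs_mul, div_div_eq_mul_div, div_one]
  nlinarith [abs_nonneg q]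

theorem weight_nonneg (hZ : IsAdmissible φ Z u₀) (N : ℕ) (α : ℕ → ℝ) (l : ℝ) :
    0 ≤ weight Z u₀ N α l :=
  add_nonneg (hZ.nonneg_add (by positivity)) (hZ.nonneg_add (by positivity))

theorem continuous_weight (hZ : IsAdmissible φ Z u₀) (N : ℕ) (α : ℕ → ℝ) :
    Continuous (weight Z u₀ N α) := by
  have h0 := hZ.const_nonneg
  unfold weight oddSymbol
  refine Continuous.add ?_ ?_
  · exact hZ.continuousOn.comp_continuous (by fun_prop) fun x => by
      simp only [Set.mem_Ici]; positivity
  · exact hZ.continuousOn.comp_continuous (by fun_prop) fun x => by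
      simp only [Set.mem_Ici]; positivity

theorem abs_sub_waveKernel_le (hZ : IsAdmissible φ Z u₀) {κ : ℝ → ℝ}
    (hκ : κ = Real.cos ∨ κ = Real.sin) (N : ℕ) (α : ℕ → ℝ) {t x s v h : ℝ} (hh : 0 < h)
    (ht : |t - s| ≤ h) (hx : |x - v| ≤ h) (l : ℝ) :
    |waveKernel κ N α t x l - waveKernel κ N α s v l| ≤
      2 / Z (1 / h + u₀) * weight Z u₀ N α l := by
  have key : ∀ A B : ℝ, |κ A - κ B| ≤ min 2 |A - B| := by
    intro A B
    refine le_min ?_ ?_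
    · have : ∀ A, |κ A| ≤ 1 := by
        rcases hκ with rfl | rfl
        exacts [Real.abs_cos_le_one, Real.abs_sin_le_one]
      have := abs_sub (κ A) (κ B)
      linarith [this, ‹∀ A, |κ A| ≤ 1› A, ‹∀ A, |κ A| ≤ 1› B]
    · rcases hκ with rfl | rfl
      · exact Real.abs_cos_sub_cos_le A B
      · exact Real.abs_sin_sub_sin_le A B
  set p := oddSymbol N α l with hp
  have h1 : |κ (l * x + t * p) - κ (l * v + t * p)| ≤
      2 * (Z (1 / 2 * |l| + u₀) / Z (1 / h + u₀)) := by
    refine (key _ _).trans ?_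
    rw [show l * x + t * p - (l * v + t * p) = l * (x - v) by ring]
    exact hZ.two_mul_min_le hh hx
  have h2 : |κ (l * v + t * p) - κ (l * v + s * p)| ≤
      2 * (Z (1 / 2 * |p| + u₀) / Z (1 / h + u₀)) := by
    refine (key _ _).trans ?_
    rw [show l * v + t * p - (l * v + s * p) = p * (t - s) by ring]
    exact hZ.two_mul_min_le hh ht
  have h3 := abs_sub_le (κ (l * x + t * p)) (κ (l * v + t * p)) (κ (l * v + s * p))
  unfold waveKernel weight
  rw [← hp]
  refine h3.trans ((add_le_add h1 h2).trans (le_of_eq ?_))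
  rw [show 1 / 2 * |l| = |l| / 2 by ring]
  ring

end IsAdmissible

/-! ### Second moments of mean-square Stieltjes integrals -/

section SecondMoments

variable {Ω : Type*} [MeasurableSpace Ω] {P : Measure Ω} {y : ℝ → Ω → ℝ}

theorem eLpNorm_two_sq {X : Ω → ℝ} (hX : MemLp X 2 P) :
    eLpNorm X 2 P ^ 2 = ENNReal.ofReal (∫ ω, X ω ^ 2 ∂P) := by
  have h1 : eLpNorm X 2 P ^ 2 = ∫⁻ ω, ‖X ω‖ₑ ^ 2 ∂P := by
    have h := eLpNorm_nnreal_pow_eq_lintegral (μ := P) (f := X) (p := 2) two_ne_zero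
    simpa only [NNReal.coe_ofNat, ENNReal.rpow_ofNat, ENNReal.coe_ofNat] using h
  rw [h1, ofReal_integral_eq_lintegral_ofReal hX.integrable_sq
    (ae_of_all _ fun ω => sq_nonneg _)]
  refine lintegral_congr fun ω => ?_
  rw [← sq_abs, ENNReal.ofReal_pow (abs_nonneg _), Real.enorm_eq_ofReal_abs]

theorem toReal_eLpNorm_two {X : Ω → ℝ} (hX : MemLp X 2 P) :
    (eLpNorm X 2 P).toReal = Real.sqrt (∫ ω, X ω ^ 2 ∂P) := by
  rw [eq_comm, Real.sqrt_eq_iff_mul_self_eq (integral_nonneg fun ω => sq_nonneg _)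
    ENNReal.toReal_nonneg, ← sq, ← ENNReal.toReal_pow, eLpNorm_two_sq hX,
    ENNReal.toReal_ofReal (integral_nonneg fun ω => sq_nonneg _)]

theorem integral_increment_mul (hy : ∀ t, MemLp (y t) 2 P) (s s' t t' : ℝ) :
    ∫ ω, (y s' ω - y s ω) * (y t' ω - y t ω) ∂P = rectIncrement (covFun P y) s s' t t' := by
  have hi : ∀ a b, Integrable (fun ω => y a ω * y b ω) P := fun a b =>
    (hy a).integrable_mul (hy b)
  have : (fun ω => (y s' ω - y s ω) * (y t' ω - y t ω)) = fun ω =>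
      y s' ω * y t' ω - y s ω * y t' ω - y s' ω * y t ω + y s ω * y t ω := by
    funext ω; ring
  have h1 := (hi s' t').sub (hi s t')
  have h2 := h1.sub (hi s' t)
  have e1 := integral_sub (hi s' t') (hi s t')
  have e2 := integral_sub h1 (hi s' t)
  have e3 := integral_add h2 (hi s t)
  simp only [Pi.sub_apply] at e2 e3
  rw [this, e3, e2, e1]
  rfl

theorem integral_sq_riemannSum (hy : ∀ t, MemLp (y t) 2 P) (n : ℕ) (a p : ℕ → ℝ) :
    ∫ ω, (∑ i ∈ Finset.range n, a i * (y (p (i + 1)) ω - y (p i) ω)) ^ 2 ∂P =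
      ∑ i ∈ Finset.range n, ∑ j ∈ Finset.range n,
        a i * a j * rectIncrement (covFun P y) (p i) (p (i + 1)) (p j) (p (j + 1)) := by
  have hi : ∀ i j, Integrable (fun ω => (a i * a j) *
      ((y (p (i + 1)) ω - y (p i) ω) * (y (p (j + 1)) ω - y (p j) ω))) P := fun i j =>
    (((hy _).sub (hy _)).integrable_mul ((hy _).sub (hy _))).const_mul _
  have : (fun ω => (∑ i ∈ Finset.range n, a i * (y (p (i + 1)) ω - y (p i) ω)) ^ 2) =
      fun ω => ∑ i ∈ Finset.range n, ∑ j ∈ Finset.range n, (a i * a j) *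
        ((y (p (i + 1)) ω - y (p i) ω) * (y (p (j + 1)) ω - y (p j) ω)) := by
    funext ω
    rw [sq, Finset.sum_mul_sum]
    refine Finset.sum_congr rfl fun i _ => Finset.sum_congr rfl fun j _ => by ring
  rw [this, integral_finsetSum _ fun i _ => integrable_finsetSum _ fun j _ => hi i j]
  refine Finset.sum_congr rfl fun i _ => ?_
  rw [integral_finsetSum _ fun j _ => hi i j]
  refine Finset.sum_congr rfl fun j _ => ?_
  rw [integral_const_mul, integral_increment_mul hy]

theorem memLp_riemannSum (hy : ∀ t, MemLp (y t) 2 P) (n : ℕ) (a p : ℕ → ℝ) :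
    MemLp (fun ω => ∑ i ∈ Finset.range n, a i * (y (p (i + 1)) ω - y (p i) ω)) 2 P :=
  memLp_finsetSum _ fun i _ => ((hy _).sub (hy _)).const_mul (a i)

theorem sum_enorm_rectIncrement_le (G : ℝ → ℝ → ℝ) (n : ℕ) {p : ℕ → ℝ} (hp : Monotone p) :
    ∑ i ∈ Finset.range n, ∑ j ∈ Finset.range n,
      ‖rectIncrement G (p i) (p (i + 1)) (p j) (p (j + 1))‖ₑ ≤ totalVariation G := by
  unfold totalVariation varIntegral
  refine le_iSup_of_le n (le_iSup_of_le n (le_iSup_of_le p (le_iSup_of_le p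
    (le_iSup_of_le hp (le_iSup_of_le hp ?_)))))
  refine Finset.sum_le_sum fun i _ => Finset.sum_le_sum fun j _ => ?_
  refine le_mul_of_one_le_left' ?_
  simp

/-- On a fine grid, a tagged upper sum exceeds the lower sum by at most `η` times the total
variation. -/
theorem sum_le_varIntegral_add (G : ℝ → ℝ → ℝ) (g : ℝ → ℝ → ℝ≥0∞) (n : ℕ) {p : ℕ → ℝ}
    (hp : Monotone p) (η : ℝ≥0∞) (hη : ∀ i < n, ∀ j < n, ∀ u ∈ Set.Icc (p i) (p (i + 1)),
      ∀ v ∈ Set.Icc (p j) (p (j + 1)), g (p i) (p j) ≤ g u v + η) :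
    ∑ i ∈ Finset.range n, ∑ j ∈ Finset.range n,
      g (p i) (p j) * ‖rectIncrement G (p i) (p (i + 1)) (p j) (p (j + 1))‖ₑ ≤
      varIntegral G g + η * totalVariation G := by
  have h1 : ∀ i < n, ∀ j < n, g (p i) (p j) ≤
      (⨅ u ∈ Set.Icc (p i) (p (i + 1)), ⨅ v ∈ Set.Icc (p j) (p (j + 1)), g u v) + η := by
    intro i hi j hj
    rw [← tsub_le_iff_right]
    exact le_iInf₂ fun u hu => le_iInf₂ fun v hv =>
      tsub_le_iff_right.2 (hη i hi j hj u hu v hv)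
  calc _ ≤ ∑ i ∈ Finset.range n, ∑ j ∈ Finset.range n,
        ((⨅ u ∈ Set.Icc (p i) (p (i + 1)), ⨅ v ∈ Set.Icc (p j) (p (j + 1)), g u v) *
          ‖rectIncrement G (p i) (p (i + 1)) (p j) (p (j + 1))‖ₑ +
          η * ‖rectIncrement G (p i) (p (i + 1)) (p j) (p (j + 1))‖ₑ) := by
        refine Finset.sum_le_sum fun i hi => Finset.sum_le_sum fun j hj => ?_
        rw [← add_mul]
        exact mul_le_mul_left (h1 i (Finset.mem_range.1 hi) j (Finset.mem_range.1 hj)) _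
    _ ≤ _ := by
        simp_rw [Finset.sum_add_distrib, ← Finset.mul_sum]
        refine add_le_add ?_ (mul_le_mul_right (sum_enorm_rectIncrement_le G n hp) _)
        exact le_iSup_of_le n (le_iSup_of_le n (le_iSup_of_le p (le_iSup_of_le p
          (le_iSup_of_le hp (le_iSup_of_le hp le_rfl)))))

theorem eLpNorm_riemannSum_sq_le (hy : ∀ t, MemLp (y t) 2 P) {f w : ℝ → ℝ} {c : ℝ}
    (hw0 : ∀ l, 0 ≤ w l) (hf : ∀ l, |f l| ≤ c * w l) (n : ℕ) {p : ℕ → ℝ}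
    (hp : Monotone p) (η : ℝ) (hη : ∀ i < n, ∀ j < n, ∀ u ∈ Set.Icc (p i) (p (i + 1)),
      ∀ v ∈ Set.Icc (p j) (p (j + 1)), w (p i) * w (p j) ≤ w u * w v + η) :
    eLpNorm (fun ω => ∑ i ∈ Finset.range n, f (p i) * (y (p (i + 1)) ω - y (p i) ω)) 2 P ^ 2 ≤
      ENNReal.ofReal (c ^ 2) * (varIntegral (covFun P y)
        (fun l m => ENNReal.ofReal (w l * w m)) +
          ENNReal.ofReal η * totalVariation (covFun P y)) := by
  rw [eLpNorm_two_sq (memLp_riemannSum hy n (fun i => f (p i)) p),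
    integral_sq_riemannSum hy n (fun i => f (p i)) p]
  refine le_trans ?_ (mul_le_mul_right (sum_le_varIntegral_add (covFun P y)
    (fun l m => ENNReal.ofReal (w l * w m)) n hp (ENNReal.ofReal η) ?_) _)
  · simp_rw [Finset.mul_sum]
    refine (Real.ofReal_le_enorm _).trans ((enorm_sum_le _ _).trans ?_)
    refine Finset.sum_le_sum fun i _ => (enorm_sum_le _ _).trans ?_
    refine Finset.sum_le_sum fun j _ => ?_
    rw [Real.enorm_eq_ofReal_abs, Real.enorm_eq_ofReal_abs,
      ← ENNReal.ofReal_mul (mul_nonneg (hw0 _) (hw0 _)), ← ENNReal.ofReal_mul (sq_nonneg c)]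
    refine ENNReal.ofReal_le_ofReal ?_
    rw [abs_mul, abs_mul, ← mul_assoc (c ^ 2)]
    refine mul_le_mul_of_nonneg_right ?_ (abs_nonneg _)
    calc |f (p i)| * |f (p j)| ≤ (c * w (p i)) * (c * w (p j)) :=
          mul_le_mul (hf _) (hf _) (abs_nonneg (f (p j))) ((abs_nonneg (f (p i))).trans (hf _))
      _ = _ := by ring
  · intro i hi j hj u hu v hv
    exact (ENNReal.ofReal_le_ofReal (hη i hi j hj u hu v hv)).trans ENNReal.ofReal_add_le

/-- Uniform partitions fine enough for a given mesh and for the oscillation of `w ⊗ w`. -/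
theorem exists_fine_partition {w : ℝ → ℝ} (hw : Continuous w) {A B : ℝ} (hAB : A ≤ B)
    {δ η : ℝ} (hδ : 0 < δ) (hη : 0 < η) :
    ∃ (n : ℕ) (p : ℕ → ℝ), Monotone p ∧ IsTaggedPartition A B δ n p p ∧
      ∀ i < n, ∀ j < n, ∀ u ∈ Set.Icc (p i) (p (i + 1)), ∀ v ∈ Set.Icc (p j) (p (j + 1)),
        w (p i) * w (p j) ≤ w u * w v + η := by
  have hK : IsCompact (Set.Icc A B ×ˢ Set.Icc A B) := isCompact_Icc.prod isCompact_Icc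
  have huc := hK.uniformContinuousOn_of_continuous
    (f := fun r : ℝ × ℝ => w r.1 * w r.2) (by fun_prop)
  obtain ⟨ρ, hρ, hosc⟩ := Metric.uniformContinuousOn_iff.1 huc η hη
  obtain ⟨n, hn⟩ := exists_nat_gt ((B - A) / min δ ρ)
  have hm : 0 < min δ ρ := lt_min hδ hρ
  have hn0 : (0 : ℝ) < n := lt_of_le_of_lt (div_nonneg (sub_nonneg.2 hAB) hm.le) hn
  have hstep : (B - A) / n < min δ ρ := by
    rw [div_lt_iff₀ hm] at hn
    rw [div_lt_iff₀ hn0]; linarith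
  have hstep0 : 0 ≤ (B - A) / n := div_nonneg (sub_nonneg.2 hAB) hn0.le
  let p : ℕ → ℝ := fun i => A + i * ((B - A) / n)
  have hsucc : ∀ i, p (i + 1) = p i + (B - A) / n := fun i => by
    simp only [p]; push_cast; ring
  have hp : Monotone p := monotone_nat_of_le_succ fun i => by rw [hsucc]; linarith
  have hp0 : p 0 = A := by simp [p]
  have hpn : p n = B := by simp only [p]; field_simp; ring
  refine ⟨n, p, hp, ⟨hp0, hpn, fun i _ => hp i.le_succ, fun i _ => ?_, fun i _ =>
    ⟨le_rfl, hp i.le_succ⟩⟩, fun i hi j hj u hu v hv => ?_⟩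
  · rw [hsucc, add_sub_cancel_left]
    exact hstep.trans_le (min_le_left _ _)
  · have hmem : ∀ i < n, ∀ u ∈ Set.Icc (p i) (p (i + 1)), u ∈ Set.Icc A B := fun i hi u hu =>
      ⟨(hp0.ge.trans (hp (Nat.zero_le _))).trans hu.1, hu.2.trans ((hp hi).trans hpn.le)⟩
    have hd : ∀ i, ∀ u ∈ Set.Icc (p i) (p (i + 1)), dist (p i) u < ρ := fun i u hu => by
      have h1 := hu.1
      have h2 := hu.2
      rw [hsucc] at h2
      have := min_le_right δ ρ
      rw [dist_comm, Real.dist_eq, abs_of_nonneg (by linarith)]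
      linarith
    have hself : ∀ i, p i ∈ Set.Icc (p i) (p (i + 1)) := fun i => ⟨le_rfl, hp i.le_succ⟩
    have := hosc (p i, p j) ⟨hmem i hi _ (hself i), hmem j hj _ (hself j)⟩ (u, v)
      ⟨hmem i hi u hu, hmem j hj v hv⟩ (max_lt (hd i u hu) (hd j v hv))
    rw [Real.dist_eq] at this
    linarith [(abs_lt.1 this).2]

theorem HasMSIntegralOn.eLpNorm_le (hy : ∀ t, MemLp (y t) 2 P)
    (hvar : totalVariation (covFun P y) < ⊤) {f w : ℝ → ℝ} {c : ℝ}
    (hw : Continuous w) (hw0 : ∀ l, 0 ≤ w l) (hf : ∀ l, |f l| ≤ c * w l)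
    {A B : ℝ} (hAB : A ≤ B) {J : Ω → ℝ} (hJ : HasMSIntegralOn P y f A B J) :
    eLpNorm J 2 P ≤ (ENNReal.ofReal (c ^ 2) * varIntegral (covFun P y)
      (fun l m => ENNReal.ofReal (w l * w m))) ^ (1 / 2 : ℝ) := by
  set V := varIntegral (covFun P y) (fun l m => ENNReal.ofReal (w l * w m)) with hV
  set T := totalVariation (covFun P y) with hT
  have key : ∀ ε : ℝ, 0 < ε → eLpNorm J 2 P ≤
      (ENNReal.ofReal (c ^ 2) * (V + ENNReal.ofReal ε * T)) ^ (1 / 2 : ℝ) +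
        ENNReal.ofReal ε := by
    intro ε hε
    obtain ⟨δ, hδ, hδJ⟩ := hJ.2 (ENNReal.ofReal ε) (ENNReal.ofReal_pos.2 hε)
    obtain ⟨n, p, hp, htag, hosc⟩ := exists_fine_partition hw hAB hδ hε
    have h1 := hδJ n p p htag
    have h2 := eLpNorm_riemannSum_sq_le hy hw0 hf n hp ε hosc
    set R : Ω → ℝ := fun ω => ∑ i ∈ Finset.range n, f (p i) * (y (p (i + 1)) ω - y (p i) ω)
      with hR
    have hRm : MemLp R 2 P := memLp_riemannSum hy n (fun i => f (p i)) p
    have h3 : eLpNorm J 2 P ≤ eLpNorm R 2 P + eLpNorm (R - J) 2 P := by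
      have : J = R - (R - J) := by simp
      conv_lhs => rw [this]
      exact eLpNorm_sub_le hRm.1 (hRm.1.sub hJ.1.1) one_le_two
    refine h3.trans (add_le_add ?_ h1)
    rwa [one_div, ENNReal.le_rpow_inv_iff two_pos, ENNReal.rpow_ofNat]
  have hlim : Tendsto (fun ε : ℝ => (ENNReal.ofReal (c ^ 2) *
      (V + ENNReal.ofReal ε * T)) ^ (1 / 2 : ℝ) + ENNReal.ofReal ε) (𝓝[>] 0)
      (𝓝 ((ENNReal.ofReal (c ^ 2) * (V + ENNReal.ofReal 0 * T)) ^ (1 / 2 : ℝ) +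
        ENNReal.ofReal 0)) := by
    have h0 : Tendsto (fun ε : ℝ => ENNReal.ofReal ε) (𝓝[>] 0) (𝓝 (ENNReal.ofReal 0)) :=
      (ENNReal.continuous_ofReal.tendsto 0).mono_left nhdsWithin_le_nhds
    refine Tendsto.add ?_ h0
    refine ((ENNReal.continuous_rpow_const (y := 1 / 2)).tendsto _).comp ?_
    refine ENNReal.Tendsto.const_mul ?_ (Or.inr ENNReal.ofReal_ne_top)
    exact tendsto_const_nhds.add (ENNReal.Tendsto.mul_const h0 (Or.inr hvar.ne))
  have := ge_of_tendsto hlim (eventually_nhdsWithin_of_forall fun ε hε => key ε hε)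
  simpa using this

/-- The second moment of `∫ f dy` is at most `c² ∫∫ w ⊗ w d|Γ_y|` when `|f| ≤ c w`. -/
theorem HasMSIntegral.toReal_eLpNorm_le (hy : ∀ t, MemLp (y t) 2 P)
    (hvar : totalVariation (covFun P y) < ⊤) {f w : ℝ → ℝ} {c : ℝ} (hc : 0 ≤ c)
    (hw : Continuous w) (hw0 : ∀ l, 0 ≤ w l) (hf : ∀ l, |f l| ≤ c * w l)
    (hV : varIntegral (covFun P y) (fun l m => ENNReal.ofReal (w l * w m)) < ⊤)
    {X : Ω → ℝ} (hX : HasMSIntegral P y f X) :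
    (eLpNorm X 2 P).toReal ≤ c * Real.sqrt (varIntegral (covFun P y)
      (fun l m => ENNReal.ofReal (w l * w m))).toReal := by
  set V := varIntegral (covFun P y) (fun l m => ENNReal.ofReal (w l * w m))
  obtain ⟨hXm, J, hJ, hlim⟩ := hX
  have hle : eLpNorm X 2 P ≤ (ENNReal.ofReal (c ^ 2) * V) ^ (1 / 2 : ℝ) := by
    have h1 := hlim.const_add ((ENNReal.ofReal (c ^ 2) * V) ^ (1 / 2 : ℝ))
    rw [add_zero] at h1
    refine ge_of_tendsto h1 ?_
    have hev : ∀ᶠ r : ℝ × ℝ in atBot ×ˢ atTop, r.1 ≤ r.2 :=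
      ((eventually_le_atBot (0 : ℝ)).prod_mk (eventually_ge_atTop (0 : ℝ))).mono
        fun r hr => hr.1.trans hr.2
    filter_upwards [hev] with r hr
    have hJr := hJ r.1 r.2 hr
    refine le_trans ?_ (add_le_add_left (hJr.eLpNorm_le hy hvar hw hw0 hf hr) _)
    have : X = J r.1 r.2 - (J r.1 r.2 - X) := by simp
    conv_lhs => rw [this]
    exact eLpNorm_sub_le hJr.1.1 (hJr.1.1.sub hXm.1) one_le_two
  have h2 := ENNReal.toReal_mono (ENNReal.rpow_ne_top_of_nonneg (by norm_num)
    (ENNReal.mul_ne_top ENNReal.ofReal_ne_top hV.ne)) hle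
  rwa [← ENNReal.toReal_rpow, ENNReal.toReal_mul, ENNReal.toReal_ofReal (sq_nonneg c),
    ← Real.sqrt_eq_rpow, Real.sqrt_mul (sq_nonneg c), Real.sqrt_sq hc] at h2

theorem HasMSIntegralOn.sub {f g : ℝ → ℝ} (hy : ∀ t, MemLp (y t) 2 P) {A B : ℝ} {J L : Ω → ℝ}
    (hJ : HasMSIntegralOn P y f A B J) (hL : HasMSIntegralOn P y g A B L) :
    HasMSIntegralOn P y (f - g) A B (J - L) := by
  refine ⟨hJ.1.sub hL.1, fun ε hε => ?_⟩
  obtain ⟨δ₁, h1, H1⟩ := hJ.2 (ε / 2) (ENNReal.half_pos hε.ne')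
  obtain ⟨δ₂, h2, H2⟩ := hL.2 (ε / 2) (ENNReal.half_pos hε.ne')
  refine ⟨min δ₁ δ₂, lt_min h1 h2, fun n p τ hp => ?_⟩
  have e1 := H1 n p τ ⟨hp.left, hp.right, hp.le,
    fun i hi => (hp.mesh i hi).trans_le (min_le_left _ _), hp.tag⟩
  have e2 := H2 n p τ ⟨hp.left, hp.right, hp.le,
    fun i hi => (hp.mesh i hi).trans_le (min_le_right _ _), hp.tag⟩
  have m1 := (memLp_riemannSum hy n (fun i => f (τ i)) p).sub hJ.1
  have m2 := (memLp_riemannSum hy n (fun i => g (τ i)) p).sub hL.1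
  have := eLpNorm_sub_le m1.1 m2.1 one_le_two
  refine le_trans (le_of_eq ?_) (this.trans ((add_le_add e1 e2).trans (ENNReal.add_halves ε).le))
  congr 1
  funext ω
  simp only [Pi.sub_apply, sub_mul, Finset.sum_sub_distrib]
  ring

theorem HasMSIntegral.sub {f g : ℝ → ℝ} (hy : ∀ t, MemLp (y t) 2 P) {X Y : Ω → ℝ}
    (hX : HasMSIntegral P y f X) (hY : HasMSIntegral P y g Y) :
    HasMSIntegral P y (f - g) (X - Y) := by
  obtain ⟨hXm, J, hJ, hJX⟩ := hX
  obtain ⟨hYm, L, hL, hLY⟩ := hY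
  refine ⟨hXm.sub hYm, fun A B => J A B - L A B, fun A B h => (hJ A B h).sub hy (hL A B h), ?_⟩
  have hlim := hJX.add hLY
  rw [add_zero] at hlim
  refine tendsto_of_tendsto_of_tendsto_of_le_of_le' tendsto_const_nhds hlim
    (Eventually.of_forall fun _ => zero_le) ?_
  have hev : ∀ᶠ r : ℝ × ℝ in atBot ×ˢ atTop, r.1 ≤ r.2 :=
    ((eventually_le_atBot (0 : ℝ)).prod_mk (eventually_ge_atTop (0 : ℝ))).mono
      fun r hr => hr.1.trans hr.2
  filter_upwards [hev] with r hr
  refine le_trans (le_of_eq ?_) (eLpNorm_sub_le ((hJ _ _ hr).1.sub hXm).1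
    ((hL _ _ hr).1.sub hYm).1 one_le_two)
  congr 1
  funext ω
  simp only [Pi.sub_apply]
  ring

end SecondMoments

/-! ### Exponential moments of mean-square limits -/

section ExponentialMoments

variable {Ω : Type*} [MeasurableSpace Ω] {P : Measure Ω} {y : ℝ → Ω → ℝ}

theorem MemSub.memLp_two {φ : ℝ → ℝ} {ζ : Ω → ℝ} (h : MemSub φ P ζ) : MemLp ζ 2 P := by
  refine (memLp_two_iff_integrable_sq h.integrable.1).2 ?_
  exact integrable_pow_of_integrable_exp_mul one_ne_zero (h.exp_integrable 1)
    (h.exp_integrable (-1)) 2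

theorem MemSub.lintegral_exp_le {φ : ℝ → ℝ} (hφ : IsNFunction φ) {ζ : Ω → ℝ}
    (h : MemSub φ P ζ) {s : ℝ} (hs : tau φ P ζ ≤ s) (l : ℝ) :
    ∫⁻ ω, ENNReal.ofReal (Real.exp (l * ζ ω)) ∂P ≤ ENNReal.ofReal (Real.exp (φ (l * s))) := by
  rw [← ofReal_integral_eq_lintegral_ofReal (h.exp_integrable l)
    (ae_of_all _ fun ω => (Real.exp_pos _).le)]
  refine ENNReal.ofReal_le_ofReal ?_
  have key : ∀ r, s < r → ∫ ω, Real.exp (l * ζ ω) ∂P ≤ Real.exp (φ (l * r)) := by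
    intro r hr
    obtain ⟨r₀, hr₀, hb⟩ := h.exists_bound
    obtain ⟨q, ⟨hq, hqb⟩, hqr⟩ := exists_lt_of_csInf_lt
      (s := {r : ℝ | 0 < r ∧ ∀ l : ℝ, ∫ ω, Real.exp (l * ζ ω) ∂P ≤ Real.exp (φ (r * l))})
      ⟨r₀, hr₀, fun l => by rw [mul_comm r₀]; exact hb l⟩ (hs.trans_lt hr)
    refine (hqb l).trans (Real.exp_le_exp.2 (hφ.le_of_abs_le_abs ?_))
    rw [mul_comm q, abs_mul, abs_mul, abs_of_pos hq, abs_of_pos (hq.trans hqr)]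
    gcongr
  have hc : Tendsto (fun r => Real.exp (φ (l * r))) (𝓝[>] s) (𝓝 (Real.exp (φ (l * s)))) := by
    have : Continuous fun r => Real.exp (φ (l * r)) :=
      Real.continuous_exp.comp (hφ.continuous.comp (by fun_prop))
    exact (this.tendsto s).mono_left nhdsWithin_le_nhds
  exact ge_of_tendsto hc (eventually_nhdsWithin_of_forall key)

/-- `X` belongs to the mean-square closure of the linear span of the variables `y t`. -/
def MemL2Span (P : Measure Ω) (y : ℝ → Ω → ℝ) (X : Ω → ℝ) : Prop :=
  MemLp X 2 P ∧ ∀ ε : ℝ≥0∞, 0 < ε →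
    ∃ S ∈ Submodule.span ℝ (Set.range y), eLpNorm (S - X) 2 P ≤ ε

theorem HasMSIntegral.memL2Span {f : ℝ → ℝ} {X : Ω → ℝ} (h : HasMSIntegral P y f X)
    (hy : ∀ t, MemLp (y t) 2 P) : MemL2Span P y X := by
  obtain ⟨hX, J, hJ, hlim⟩ := h
  refine ⟨hX, fun ε hε => ?_⟩
  have h2 : (0 : ℝ≥0∞) < ε / 2 := ENNReal.half_pos hε.ne'
  have hev : ∀ᶠ r : ℝ × ℝ in atBot ×ˢ atTop, r.1 ≤ r.2 :=
    ((eventually_le_atBot (0 : ℝ)).prod_mk (eventually_ge_atTop (0 : ℝ))).mono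
      fun r hr => hr.1.trans hr.2
  obtain ⟨r, hr, hrX⟩ := (hev.and (hlim.eventually_le_const h2)).exists
  have hJr := hJ r.1 r.2 hr
  obtain ⟨δ, hδ, H⟩ := hJr.2 (ε / 2) h2
  obtain ⟨n, p, -, hp, -⟩ := exists_fine_partition (w := fun _ => 0) continuous_const hr hδ one_pos
  refine ⟨fun ω => ∑ i ∈ Finset.range n, f (p i) * (y (p (i + 1)) ω - y (p i) ω), ?_, ?_⟩
  · have : (fun ω => ∑ i ∈ Finset.range n, f (p i) * (y (p (i + 1)) ω - y (p i) ω)) =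
        ∑ i ∈ Finset.range n, f (p i) • (y (p (i + 1)) - y (p i)) := by
      funext ω
      simp
    rw [this]
    exact Submodule.sum_mem _ fun i _ => Submodule.smul_mem _ _
      (Submodule.sub_mem _ (Submodule.subset_span ⟨_, rfl⟩) (Submodule.subset_span ⟨_, rfl⟩))
  · have m1 := (memLp_riemannSum hy n (fun i => f (p i)) p).sub hJr.1
    have := eLpNorm_add_le m1.1 (hJr.1.sub hX).1 one_le_two
    rw [sub_add_sub_cancel] at this
    exact this.trans ((add_le_add (H n p p hp) hrX).trans (ENNReal.add_halves ε).le)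

theorem memLp_of_mem_span (hy : ∀ t, MemLp (y t) 2 P) {S : Ω → ℝ}
    (hS : S ∈ Submodule.span ℝ (Set.range y)) : MemLp S 2 P := by
  induction hS using Submodule.span_induction with
  | mem x hx => obtain ⟨t, rfl⟩ := hx; exact hy t
  | zero => exact MemLp.zero
  | add x z _ _ hx hz => exact hx.add hz
  | smul a x _ hx => exact hx.const_smul a

theorem IsStrictlySub.of_mem_span {φ : ℝ → ℝ} {Cy : ℝ} (hy : IsStrictlySub φ P y Cy) {S : Ω → ℝ}
    (hS : S ∈ Submodule.span ℝ (Set.range y)) :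
    MemSub φ P S ∧ tau φ P S ≤ Cy * (eLpNorm S 2 P).toReal := by
  have hSm := memLp_of_mem_span (fun t => (hy.memSub t).memLp_two) hS
  rw [toReal_eLpNorm_two hSm]
  obtain ⟨n, f, g, hfg⟩ := Submodule.mem_span_set'.1 hS
  choose t ht using fun i => (g i).2
  refine hy.tau_le (fun k => if h : k < n then t ⟨k, h⟩ else 0)
    (fun k => if h : k < n then f ⟨k, h⟩ else 0) S hSm ?_
  refine tendsto_const_nhds.congr' ?_
  filter_upwards [eventually_ge_atTop n] with m hm
  have : ∀ ω, (∑ k ∈ Finset.range m, (if h : k < n then f ⟨k, h⟩ else 0) *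
      y (if h : k < n then t ⟨k, h⟩ else 0) ω) = S ω := by
    intro ω
    rw [← Finset.sum_subset (Finset.range_mono hm), Finset.sum_range, ← hfg]
    · simp [ht]
    · intro k _ hk
      simp only [Finset.mem_range, not_lt] at hk
      simp [hk.not_gt]
  simp_rw [this, sub_self]
  simp

/-- The defining inequality of a strictly `φ`-sub-Gaussian process passes from finite linear
combinations to mean-square limits by Fatou's lemma. -/
theorem IsStrictlySub.lintegral_exp_le {φ : ℝ → ℝ} (hφ : IsNFunction φ) {Cy : ℝ}
    (hy : IsStrictlySub φ P y Cy) {X : Ω → ℝ} (hX : MemL2Span P y X) {s : ℝ}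
    (hs : Cy * (eLpNorm X 2 P).toReal ≤ s) (l : ℝ) :
    ∫⁻ ω, ENNReal.ofReal (Real.exp (l * X ω)) ∂P ≤ ENNReal.ofReal (Real.exp (φ (l * s))) := by
  have hy2 : ∀ t, MemLp (y t) 2 P := fun t => (hy.memSub t).memLp_two
  have hpos : ∀ n : ℕ, (0 : ℝ) < 1 / ((n : ℝ) + 1) := fun n => Nat.one_div_pos_of_nat
  choose S hS hSX using fun n : ℕ =>
    hX.2 (ENNReal.ofReal (1 / ((n : ℝ) + 1))) (ENNReal.ofReal_pos.2 (hpos n))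
  have hSm : ∀ n, MemLp (S n) 2 P := fun n => memLp_of_mem_span hy2 (hS n)
  have h0 : Tendsto (fun n : ℕ => 1 / ((n : ℝ) + 1)) atTop (𝓝 0) :=
    tendsto_one_div_add_atTop_nhds_zero_nat
  have hlim : Tendsto (fun n => eLpNorm (S n - X) 2 P) atTop (𝓝 0) := by
    have := (ENNReal.continuous_ofReal.tendsto 0).comp h0
    rw [ENNReal.ofReal_zero] at this
    exact tendsto_of_tendsto_of_tendsto_of_le_of_le tendsto_const_nhds this
      (fun _ => zero_le) hSX
  obtain ⟨ns, hns, hae⟩ := (tendstoInMeasure_of_tendsto_eLpNorm two_ne_zero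
    (fun n => (hSm n).1) hX.1.1 hlim).exists_seq_tendsto_ae
  have hnorm : ∀ n, Cy * (eLpNorm (S n) 2 P).toReal ≤ s + Cy * (1 / ((n : ℝ) + 1)) := by
    intro n
    have h1 : eLpNorm (S n) 2 P ≤ eLpNorm X 2 P + ENNReal.ofReal (1 / ((n : ℝ) + 1)) := by
      have := eLpNorm_add_le ((hSm n).sub hX.1).1 hX.1.1 one_le_two
      rw [sub_add_cancel, add_comm] at this
      exact this.trans (add_le_add_right (hSX n) _)
    have h2 := ENNReal.toReal_mono (ENNReal.add_ne_top.2
      ⟨hX.1.2.ne, ENNReal.ofReal_ne_top⟩) h1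
    rw [ENNReal.toReal_add hX.1.2.ne ENNReal.ofReal_ne_top,
      ENNReal.toReal_ofReal (hpos n).le] at h2
    have := mul_le_mul_of_nonneg_left h2 hy.const_nonneg
    linarith
  have hb : ∀ n, ∫⁻ ω, ENNReal.ofReal (Real.exp (l * S n ω)) ∂P ≤
      ENNReal.ofReal (Real.exp (φ (l * (s + Cy * (1 / ((n : ℝ) + 1)))))) := fun n =>
    (hy.of_mem_span (hS n)).1.lintegral_exp_le hφ ((hy.of_mem_span (hS n)).2.trans (hnorm n)) l
  have hbl : Tendsto (fun n : ℕ =>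
      ENNReal.ofReal (Real.exp (φ (l * (s + Cy * (1 / ((n : ℝ) + 1))))))) atTop
      (𝓝 (ENNReal.ofReal (Real.exp (φ (l * s))))) := by
    have hc : Continuous fun r : ℝ => ENNReal.ofReal (Real.exp (φ (l * (s + Cy * r)))) :=
      ENNReal.continuous_ofReal.comp (Real.continuous_exp.comp (hφ.continuous.comp (by fun_prop)))
    have := (hc.tendsto 0).comp h0
    simp only [mul_zero, add_zero] at this
    exact this
  calc ∫⁻ ω, ENNReal.ofReal (Real.exp (l * X ω)) ∂P
      = ∫⁻ ω, liminf (fun k => ENNReal.ofReal (Real.exp (l * S (ns k) ω))) atTop ∂P := by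
        refine lintegral_congr_ae ?_
        filter_upwards [hae] with ω hω
        have hc : Continuous fun r : ℝ => ENNReal.ofReal (Real.exp (l * r)) :=
          ENNReal.continuous_ofReal.comp (Real.continuous_exp.comp (by fun_prop))
        exact (((hc.tendsto _).comp hω).liminf_eq).symm
    _ ≤ liminf (fun k => ∫⁻ ω, ENNReal.ofReal (Real.exp (l * S (ns k) ω)) ∂P) atTop :=
        lintegral_liminf_le' fun k => ENNReal.measurable_ofReal.comp_aemeasurable
          (Real.measurable_exp.comp_aemeasurable ((hSm _).1.aemeasurable.const_mul l))
    _ ≤ liminf (fun k => ENNReal.ofReal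
          (Real.exp (φ (l * (s + Cy * (1 / ((ns k : ℝ) + 1))))))) atTop :=
        liminf_le_liminf (Eventually.of_forall fun k => hb (ns k))
    _ = _ := (hbl.comp hns.tendsto_atTop).liminf_eq

/-- A variable whose exponential moments are all at most `1` vanishes. -/
theorem ae_eq_zero_of_lintegral_exp_le_one [IsProbabilityMeasure P] {X : Ω → ℝ}
    (hX : AEMeasurable X P)
    (h : ∀ l : ℝ, ∫⁻ ω, ENNReal.ofReal (Real.exp (l * X ω)) ∂P ≤ 1) : ∀ᵐ ω ∂P, X ω = 0 := by
  have hm : ∀ l : ℝ, AEMeasurable (fun ω => ENNReal.ofReal (Real.exp (l * X ω))) P := fun l =>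
    ENNReal.measurable_ofReal.comp_aemeasurable
      (Real.measurable_exp.comp_aemeasurable (hX.const_mul l))
  -- `2 (cosh X - 1) ≥ 0` has expectation at most `0`.
  have hcosh : ∀ x : ℝ, ENNReal.ofReal (Real.exp (1 * x)) + ENNReal.ofReal (Real.exp (-1 * x)) =
      2 + ENNReal.ofReal (2 * (Real.cosh x - 1)) := by
    intro x
    rw [← ENNReal.ofReal_add (Real.exp_pos _).le (Real.exp_pos _).le,
      show (2 : ℝ≥0∞) = ENNReal.ofReal 2 by simp, ← ENNReal.ofReal_add zero_le_two
        (by linarith [Real.one_le_cosh x]), Real.cosh_eq]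
    congr 1
    ring_nf
  have h1 : 2 + ∫⁻ ω, ENNReal.ofReal (2 * (Real.cosh (X ω) - 1)) ∂P ≤ 2 + 0 := by
    have := add_le_add (h 1) (h (-1))
    rw [← lintegral_add_left' (hm 1), one_add_one_eq_two] at this
    simp_rw [hcosh] at this
    rw [lintegral_add_left' aemeasurable_const, lintegral_const, measure_univ, mul_one] at this
    rwa [add_zero]
  have h2 := le_antisymm ((ENNReal.add_le_add_iff_left ENNReal.ofNat_ne_top).1 h1) zero_le
  rw [lintegral_eq_zero_iff' (by
    refine ENNReal.measurable_ofReal.comp_aemeasurable ?_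
    exact ((Real.continuous_cosh.measurable.comp_aemeasurable hX).sub_const 1).const_mul 2)] at h2
  filter_upwards [h2] with ω hω
  by_contra hne
  have := Real.one_lt_cosh.2 hne
  simp only [Pi.zero_apply, ENNReal.ofReal_eq_zero] at hω
  linarith

end ExponentialMoments

/-! ### Chaining -/

section Chaining

variable {Ω T : Type*} {X : T → Ω → ℝ} {π : ℕ → T → T} {V : ℕ → Finset T}

/-- The `k`-th link of a chain that ends at `s`: the value of `X` itself for `k = 0`, and the
increment from the projection `π (k - 1) s` of `s` to the previous level otherwise. -/
def link (X : T → Ω → ℝ) (π : ℕ → T → T) : ℕ → T → Ω → ℝ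
  | 0, s => X s
  | k + 1, s => X s - X (π k s)

/-- The sum over the level `V k` of the exponentials of the absolute values of the links. -/
noncomputable def levelSum (X : T → Ω → ℝ) (π : ℕ → T → T) (V : ℕ → Finset T) (k : ℕ)
    (c : ℝ) (ω : Ω) : ℝ≥0∞ :=
  ∑ s ∈ V k, ENNReal.ofReal (Real.exp (c * |link X π k s ω|))

theorem exp_link_le_levelSum_rpow {k : ℕ} {c p l : ℝ} (hp : 0 ≤ p) (hcp : c * p = l) {s : T}
    (hs : s ∈ V k) (ω : Ω) :
    ENNReal.ofReal (Real.exp (l * |link X π k s ω|)) ≤ levelSum X π V k c ω ^ p := by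
  have h1 : ENNReal.ofReal (Real.exp (c * |link X π k s ω|)) ≤ levelSum X π V k c ω :=
    Finset.single_le_sum (f := fun s => ENNReal.ofReal (Real.exp (c * |link X π k s ω|)))
      (fun _ _ => zero_le) hs
  refine le_trans (le_of_eq ?_) (ENNReal.rpow_le_rpow h1 hp)
  rw [ENNReal.ofReal_rpow_of_pos (Real.exp_pos _), ← Real.exp_mul, ← hcp]
  ring_nf

theorem one_le_levelSum_rpow {k : ℕ} {c p l : ℝ} (hp : 0 ≤ p) (hcp : c * p = l) (hl : 0 ≤ l)
    (hV : (V k).Nonempty) (ω : Ω) : 1 ≤ levelSum X π V k c ω ^ p := by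
  obtain ⟨s, hs⟩ := hV
  refine le_trans ?_ (exp_link_le_levelSum_rpow (π := π) (X := X) hp hcp hs ω)
  rw [ENNReal.one_le_ofReal]
  exact Real.one_le_exp (mul_nonneg hl (abs_nonneg _))

/-- The chain from a point of the level `V j` down to the level `V 0`. -/
theorem exp_le_prod_levelSum (hπ : ∀ k, ∀ s ∈ V (k + 1), π k s ∈ V k) {c p : ℕ → ℝ} {l : ℝ}
    (hl : 0 ≤ l) (hp : ∀ k, 0 ≤ p k) (hcp : ∀ k, c k * p k = l) (ω : Ω) (j : ℕ) :
    ∀ s ∈ V j, ENNReal.ofReal (Real.exp (l * |X s ω|)) ≤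
      ∏ k ∈ Finset.range (j + 1), levelSum X π V k (c k) ω ^ p k := by
  induction j with
  | zero =>
    intro s hs
    simpa [link] using exp_link_le_levelSum_rpow (π := π) (X := X) (hp 0) (hcp 0) hs ω
  | succ j ih =>
    intro s hs
    rw [Finset.prod_range_succ]
    refine le_trans ?_ (mul_le_mul' (ih _ (hπ j s hs))
      (exp_link_le_levelSum_rpow (π := π) (X := X) (hp _) (hcp _) hs ω))
    rw [← ENNReal.ofReal_mul (Real.exp_pos _).le, ← Real.exp_add, ← mul_add]
    refine ENNReal.ofReal_le_ofReal (Real.exp_le_exp.2 (mul_le_mul_of_nonneg_left ?_ hl))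
    have := abs_add_le (X (π j s) ω) (X s ω - X (π j s) ω)
    rwa [add_sub_cancel] at this

variable [MeasurableSpace Ω] {P : Measure Ω}

theorem aemeasurable_link (hX : ∀ t, AEMeasurable (X t) P) (k : ℕ) (s : T) :
    AEMeasurable (link X π k s) P := by
  cases k with
  | zero => exact hX s
  | succ k => exact (hX s).sub (hX _)

theorem aemeasurable_levelSum (hX : ∀ t, AEMeasurable (X t) P) (k : ℕ) (c : ℝ) :
    AEMeasurable (levelSum X π V k c) P := by
  refine Finset.aemeasurable_fun_sum _ fun s _ => ENNReal.measurable_ofReal.comp_aemeasurable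
    (Real.measurable_exp.comp_aemeasurable (AEMeasurable.const_mul ?_ c))
  exact continuous_abs.measurable.comp_aemeasurable (aemeasurable_link hX k s)

theorem lintegral_levelSum_le {φ : ℝ → ℝ} (hφ : IsNFunction φ) (hX : ∀ t, AEMeasurable (X t) P)
    {k : ℕ} {σ H : ℝ} (hcard : ((V k).card : ℝ) ≤ Real.exp H)
    (hlink : ∀ s ∈ V k, ∀ l : ℝ, ∫⁻ ω, ENNReal.ofReal (Real.exp (l * link X π k s ω)) ∂P ≤
      ENNReal.ofReal (Real.exp (φ (l * σ)))) (c : ℝ) :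
    ∫⁻ ω, levelSum X π V k c ω ∂P ≤
      ENNReal.ofReal (Real.exp (Real.log 2 + (H + φ (c * σ)))) := by
  have hm : ∀ l s, AEMeasurable
      (fun ω => ENNReal.ofReal (Real.exp (l * link X π k s ω))) P := fun l s =>
    ENNReal.measurable_ofReal.comp_aemeasurable
      (Real.measurable_exp.comp_aemeasurable ((aemeasurable_link hX k s).const_mul l))
  have hexp : ∀ d : ℝ, ENNReal.ofReal (Real.exp (c * |d|)) ≤
      ENNReal.ofReal (Real.exp (c * d)) + ENNReal.ofReal (Real.exp (-c * d)) := by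
    intro d
    rcases abs_choice d with h | h <;> rw [h]
    · exact le_self_add
    · rw [mul_neg, ← neg_mul]
      exact le_add_self
  have hone : ∀ s ∈ V k, ∫⁻ ω, ENNReal.ofReal (Real.exp (c * |link X π k s ω|)) ∂P ≤
      ENNReal.ofReal (2 * Real.exp (φ (c * σ))) := by
    intro s hs
    refine (lintegral_mono fun ω => hexp _).trans ?_
    rw [lintegral_add_left' (hm c s), two_mul, ENNReal.ofReal_add (Real.exp_pos _).le
      (Real.exp_pos _).le]
    refine add_le_add (hlink s hs c) ((hlink s hs (-c)).trans_eq ?_)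
    rw [neg_mul, hφ.even]
  have hmeas : ∀ s ∈ V k, AEMeasurable
      (fun ω => ENNReal.ofReal (Real.exp (c * |link X π k s ω|))) P := fun s _ =>
    ENNReal.measurable_ofReal.comp_aemeasurable
      (Real.measurable_exp.comp_aemeasurable ((continuous_abs.measurable.comp_aemeasurable
        (aemeasurable_link hX k s)).const_mul c))
  unfold levelSum
  rw [lintegral_finsetSum' _ hmeas]
  refine (Finset.sum_le_sum hone).trans ?_
  rw [Finset.sum_const, nsmul_eq_mul, ← ENNReal.ofReal_natCast,
    ← ENNReal.ofReal_mul (Nat.cast_nonneg _)]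
  refine ENNReal.ofReal_le_ofReal ?_
  rw [Real.exp_add, Real.exp_add, Real.exp_log two_pos]
  calc ((V k).card : ℝ) * (2 * Real.exp (φ (c * σ)))
      ≤ Real.exp H * (2 * Real.exp (φ (c * σ))) := by gcongr
    _ = _ := by ring

/-- Chaining bound in Orlicz form. The links over `V k` have standard at most `σ k`, and `V k` has
at most `exp (H k)` points; Hölder's inequality is applied to the product over the levels with the
exponents `max x (φ⁻¹ (H k)) / (l σ k)`. -/
theorem measure_exists_lt_abs_le [IsProbabilityMeasure P] {φ : ℝ → ℝ} (hφ : IsNFunction φ)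
    (hX : ∀ t, AEMeasurable (X t) P) (hV : ∀ k, (V k).Nonempty)
    (hπ : ∀ k, ∀ s ∈ V (k + 1), π k s ∈ V k) {σ H : ℕ → ℝ} (hσ : ∀ k, 0 < σ k)
    (hH : ∀ k, 0 ≤ H k) (hcard : ∀ k, ((V k).card : ℝ) ≤ Real.exp (H k))
    (hlink : ∀ k, ∀ s ∈ V k, ∀ l : ℝ,
      ∫⁻ ω, ENNReal.ofReal (Real.exp (l * link X π k s ω)) ∂P ≤
        ENNReal.ofReal (Real.exp (φ (l * σ k))))
    {l x B : ℝ} (hl : 0 < l) (hx0 : 0 < x)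
    (hx : ∀ m, l * ∑ k ∈ Finset.range m, σ k ≤ x)
    (hB : ∀ m, ∑ k ∈ Finset.range m, σ k * Psi φ (H k) ≤ B) (u : ℝ) :
    P {ω | ∃ k, ∃ s ∈ V k, u < |X s ω|} ≤
      ENNReal.ofReal (2 * Real.exp (φ x + 2 * l * B - l * u)) := by
  let r : ℕ → ℝ := fun k => max x (inverse φ (H k))
  have hr : ∀ k, 0 < r k := fun k => hx0.trans_le (le_max_left _ _)
  let p : ℕ → ℝ := fun k => l * σ k / r k
  let c : ℕ → ℝ := fun k => r k / σ k
  have hp : ∀ k, 0 ≤ p k := fun k => div_nonneg (mul_nonneg hl.le (hσ k).le) (hr k).le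
  have hcp : ∀ k, c k * p k = l := fun k => by
    have := (hr k).ne'
    have := (hσ k).ne'
    simp only [c, p]; field_simp
  have hcσ : ∀ k, c k * σ k = r k := fun k => div_mul_cancel₀ _ (hσ k).ne'
  have hsum : ∀ m, ∑ k ∈ Finset.range m, p k ≤ 1 := by
    intro m
    have h1 : ∑ k ∈ Finset.range m, p k ≤ (l * ∑ k ∈ Finset.range m, σ k) / x := by
      rw [Finset.mul_sum, Finset.sum_div]
      exact Finset.sum_le_sum fun k _ => div_le_div_of_nonneg_left
        (mul_nonneg hl.le (hσ k).le) hx0 (le_max_left _ _)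
    exact h1.trans ((div_le_one hx0).2 (hx m))
  have hexpo : ∀ m, ∑ k ∈ Finset.range m, (Real.log 2 + (H k + φ (r k))) * p k ≤
      Real.log 2 + (φ x + 2 * l * B) := by
    intro m
    have hφx : 0 ≤ φ x / x := div_nonneg (hφ.nonneg x) hx0.le
    have h1 : ∀ k ∈ Finset.range m, (Real.log 2 + (H k + φ (r k))) * p k ≤
        Real.log 2 * p k + (2 * l * (σ k * Psi φ (H k)) + l * σ k * (φ x / x)) := by
      intro k _
      have h2 := mul_le_mul_of_nonneg_left (hφ.add_div_max_le hx0 (hH k))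
        (mul_nonneg hl.le (hσ k).le)
      have h3 : (H k + φ (r k)) * p k = l * σ k * ((H k + φ (r k)) / r k) := by
        simp only [p]; ring
      rw [add_mul, h3]
      linarith
    refine (Finset.sum_le_sum h1).trans ?_
    rw [Finset.sum_add_distrib, Finset.sum_add_distrib, ← Finset.mul_sum, ← Finset.mul_sum,
      ← Finset.sum_mul, ← Finset.mul_sum]
    have h4 := mul_le_mul_of_nonneg_left (hsum m) (Real.log_nonneg one_le_two)
    have h5 := mul_le_mul_of_nonneg_right (hx m) hφx
    rw [mul_div_cancel₀ _ hx0.ne'] at h5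
    have h6 := mul_le_mul_of_nonneg_left (hB m) (mul_nonneg zero_le_two hl.le)
    linarith
  have hlevel : ∀ m, P {ω | ∃ k < m, ∃ s ∈ V k, u < |X s ω|} ≤
      ENNReal.ofReal (2 * Real.exp (φ x + 2 * l * B - l * u)) := by
    intro m
    let F : Ω → ℝ≥0∞ := fun ω => ∏ k ∈ Finset.range m, levelSum X π V k (c k) ω ^ p k
    have hFm : AEMeasurable F P :=
      Finset.aemeasurable_fun_prod _ fun k _ => (aemeasurable_levelSum hX k _).pow_const _
    have hsub : {ω | ∃ k < m, ∃ s ∈ V k, u < |X s ω|} ⊆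
        {ω | ENNReal.ofReal (Real.exp (l * u)) ≤ F ω} := by
      rintro ω ⟨k, hk, s, hs, hu⟩
      refine (ENNReal.ofReal_le_ofReal (Real.exp_le_exp.2
        (mul_le_mul_of_nonneg_left hu.le hl.le))).trans ?_
      refine (exp_le_prod_levelSum hπ hl.le hp hcp ω k s hs).trans ?_
      exact Finset.prod_le_prod_of_subset_of_one_le' (Finset.range_mono hk)
        fun i _ _ => one_le_levelSum_rpow (hp i) (hcp i) hl.le (hV i) ω
    have hint : ∫⁻ ω, F ω ∂P ≤ ENNReal.ofReal (Real.exp (Real.log 2 + (φ x + 2 * l * B))) := by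
      have h1 := ENNReal.lintegral_mul_prod_norm_pow_le (μ := P) (Finset.range m)
        (g := fun _ => 1) (f := fun k => levelSum X π V k (c k)) aemeasurable_const
        (fun k _ => aemeasurable_levelSum hX k _) (1 - ∑ k ∈ Finset.range m, p k)
        (sub_add_cancel _ _) (sub_nonneg.2 (hsum m)) (fun k _ => hp k)
      simp only [ENNReal.one_rpow, one_mul, lintegral_one, measure_univ] at h1
      refine h1.trans ?_
      have h2 : ∀ k ∈ Finset.range m, (∫⁻ ω, levelSum X π V k (c k) ω ∂P) ^ p k ≤
          ENNReal.ofReal (Real.exp ((Real.log 2 + (H k + φ (r k))) * p k)) := by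
        intro k _
        rw [Real.exp_mul, ← ENNReal.ofReal_rpow_of_pos (Real.exp_pos _), ← hcσ k]
        exact ENNReal.rpow_le_rpow (lintegral_levelSum_le hφ hX (hcard k) (hlink k) _) (hp k)
      refine (Finset.prod_le_prod' h2).trans ?_
      rw [← ENNReal.ofReal_prod_of_nonneg fun _ _ => (Real.exp_pos _).le, ← Real.exp_sum]
      exact ENNReal.ofReal_le_ofReal (Real.exp_le_exp.2 (hexpo m))
    refine (measure_mono hsub).trans ((meas_ge_le_lintegral_div hFm
      (ENNReal.ofReal_pos.2 (Real.exp_pos _)).ne' ENNReal.ofReal_ne_top).trans ?_)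
    refine (ENNReal.div_le_div_right hint _).trans_eq ?_
    rw [← ENNReal.ofReal_div_of_pos (Real.exp_pos _), ← Real.exp_sub, add_sub_assoc,
      Real.exp_add, Real.exp_log two_pos]
  have hunion : {ω | ∃ k, ∃ s ∈ V k, u < |X s ω|} =
      ⋃ m, {ω | ∃ k < m, ∃ s ∈ V k, u < |X s ω|} := by
    ext ω
    simp only [Set.mem_ofPred_eq, Set.mem_iUnion]
    exact ⟨fun ⟨k, h⟩ => ⟨k + 1, k, k.lt_succ_self, h⟩, fun ⟨_, k, _, h⟩ => ⟨k, h⟩⟩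
  have hmono : Monotone fun m => {ω | ∃ k < m, ∃ s ∈ V k, u < |X s ω|} :=
    fun a b hab ω ⟨k, hk, h⟩ => ⟨k, hk.trans_le hab, h⟩
  rw [hunion, hmono.measure_iUnion]
  exact iSup_le hlevel

end Chaining

/-! ### The entropy integral -/

section Entropy

variable {φ Z : ℝ → ℝ} {u₀ K a b c d : ℝ}

/-- The bound for the number of balls of radius `r` that cover `[a, b] × [c, d]`, at the radius
with `2 K / Z(1/r + u₀) = s`. -/
noncomputable def coverBound (Z : ℝ → ℝ) (u₀ K a b c d s : ℝ) : ℝ :=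
  ((b - a) / 2 * (inverse Z (2 * K / s) - u₀) + 1) *
    ((d - c) / 2 * (inverse Z (2 * K / s) - u₀) + 1)

theorem IsAdmissible.map_inv_pos (hZ : IsAdmissible φ Z u₀) {h : ℝ} (hh : 0 < h) :
    0 < Z (1 / h + u₀) :=
  hZ.pos _ (by have := one_div_pos.2 hh; linarith)

theorem IsAdmissible.le_inverse_sub (hZ : IsAdmissible φ Z u₀) {R s : ℝ} (hR : 0 < R)
    (hs : 0 < s) (h : s ≤ 2 * K / Z (R + u₀)) : R ≤ inverse Z (2 * K / s) - u₀ := by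
  have h0 := hZ.const_nonneg
  have hp : 0 < Z (R + u₀) := hZ.pos _ (by linarith)
  rw [le_div_iff₀ hp] at h
  have := hZ.le_inverse (x := R + u₀) (v := 2 * K / s) (by linarith) (by
    rw [le_div_iff₀ hs]; linarith)
  linarith

theorem IsAdmissible.inverse_sub_pos (hZ : IsAdmissible φ Z u₀)
    (hrect : 0 < max (b - a) (d - c)) {s : ℝ} (hs : 0 < s) (h : s ≤ gammaZero Z u₀ K a b c d) :
    0 < inverse Z (2 * K / s) - u₀ :=
  (one_div_pos.2 hrect).trans_le (hZ.le_inverse_sub (one_div_pos.2 hrect) hs h)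

theorem IsAdmissible.map_inverse_add (hZ : IsAdmissible φ Z u₀)
    (hrect : 0 < max (b - a) (d - c)) {s : ℝ} (hs : 0 < s) (h : s ≤ gammaZero Z u₀ K a b c d) :
    Z 0 ≤ 2 * K / s ∧ Z (inverse Z (2 * K / s)) = 2 * K / s := by
  have h0 := hZ.const_nonneg
  have hp := one_div_pos.2 hrect
  have h1 := hZ.map_inv_pos hrect
  have h2 : Z 0 ≤ 2 * K / s := by
    refine (hZ.mono le_rfl (by linarith : (0 : ℝ) ≤ 1 / max (b - a) (d - c) + u₀)).trans ?_
    unfold gammaZero at h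
    rw [le_div_iff₀ h1] at h
    rw [le_div_iff₀ hs]
    linarith
  exact ⟨h2, (hZ.inverse_spec h2).2⟩

theorem one_le_coverBound (hZ : IsAdmissible φ Z u₀) (hab : a ≤ b) (hcd : c ≤ d)
    (hrect : 0 < max (b - a) (d - c)) {s : ℝ} (hs : 0 < s) (h : s ≤ gammaZero Z u₀ K a b c d) :
    1 ≤ coverBound Z u₀ K a b c d s := by
  have hw := (hZ.inverse_sub_pos hrect hs h).le
  have h1 : 0 ≤ (b - a) / 2 := by linarith
  have h2 : 0 ≤ (d - c) / 2 := by linarith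
  exact one_le_mul_of_one_le_of_one_le (by linarith [mul_nonneg h1 hw])
    (by linarith [mul_nonneg h2 hw])

theorem coverBound_anti (hZ : IsAdmissible φ Z u₀) (hK : 0 ≤ K) (hab : a ≤ b) (hcd : c ≤ d)
    (hrect : 0 < max (b - a) (d - c)) {s s' : ℝ} (hs : 0 < s) (hss : s ≤ s')
    (h : s' ≤ gammaZero Z u₀ K a b c d) :
    coverBound Z u₀ K a b c d s' ≤ coverBound Z u₀ K a b c d s := by
  have hw := (hZ.inverse_sub_pos hrect (hs.trans_le hss) h).le
  have h3 : inverse Z (2 * K / s') ≤ inverse Z (2 * K / s) :=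
    inverse_le_inverse hZ.continuousOn hZ.strictMonoOn hZ.tendsto_atTop
      (hZ.map_inverse_add hrect (hs.trans_le hss) h).1
      (div_le_div_of_nonneg_left (by positivity) hs hss)
  have h1 : 0 ≤ (b - a) / 2 := by linarith
  have h2 : 0 ≤ (d - c) / 2 := by linarith
  have h4 := mul_nonneg h1 hw
  have h5 := mul_nonneg h2 hw
  have h6 : (b - a) / 2 * (inverse Z (2 * K / s') - u₀) ≤
      (b - a) / 2 * (inverse Z (2 * K / s) - u₀) := by gcongr
  unfold coverBound
  gcongr
  linarith

theorem entropyIntegrand_nonneg (hφ : IsNFunction φ) (hZ : IsAdmissible φ Z u₀) (hab : a ≤ b)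
    (hcd : c ≤ d) (hrect : 0 < max (b - a) (d - c)) {s : ℝ} (hs : 0 < s)
    (h : s ≤ gammaZero Z u₀ K a b c d) : 0 ≤ entropyIntegrand φ Z u₀ K a b c d s :=
  hφ.psi_nonneg (Real.log_nonneg (one_le_coverBound hZ hab hcd hrect hs h))

theorem antitoneOn_entropyIntegrand (hφ : IsNFunction φ) (hZ : IsAdmissible φ Z u₀) (hK : 0 ≤ K)
    (hab : a ≤ b) (hcd : c ≤ d) (hrect : 0 < max (b - a) (d - c)) :
    AntitoneOn (entropyIntegrand φ Z u₀ K a b c d) (Set.Ioc 0 (gammaZero Z u₀ K a b c d)) := by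
  intro s hs s' hs' hss
  have h1 := one_le_coverBound hZ hab hcd hrect hs'.1 hs'.2
  exact hφ.psi_mono (Real.log_nonneg h1) (Real.log_le_log (zero_lt_one.trans_le h1)
    (coverBound_anti hZ hK hab hcd hrect hs.1 hss hs'.2))

/-- For small `s` the cover bound is at most the fourth power of `Z⁻¹(2K/s) - u₀`, which compares
the entropy integrand with the rescaled integrand of the admissibility condition. -/
theorem entropyIntegrand_le (hφ : IsNFunction φ) (hab : a ≤ b) (hcd : c ≤ d) {s : ℝ}
    (h : (b - a) / 2 + (d - c) / 2 + 1 ≤ inverse Z (2 * K / s) - u₀) :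
    entropyIntegrand φ Z u₀ K a b c d s ≤
      4 * Psi φ (Real.log (inverse Z (2 * K / s) - u₀)) := by
  unfold entropyIntegrand
  set w := inverse Z (2 * K / s) - u₀
  have h1 : 0 ≤ (b - a) / 2 := by linarith
  have h2 : 0 ≤ (d - c) / 2 := by linarith
  have hw : 1 ≤ w := by linarith
  have e1 : (b - a) / 2 * w + 1 ≤ w ^ 2 := by nlinarith
  have e2 : (d - c) / 2 * w + 1 ≤ w ^ 2 := by nlinarith
  have g1 : 1 ≤ (b - a) / 2 * w + 1 := by nlinarith
  have g2 : 1 ≤ (d - c) / 2 * w + 1 := by nlinarith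
  have h3 : Real.log (((b - a) / 2 * w + 1) * ((d - c) / 2 * w + 1)) ≤ 4 * Real.log w := by
    have : (4 : ℝ) * Real.log w = Real.log (w ^ 4) := by
      rw [Real.log_pow]; norm_num
    rw [this]
    refine Real.log_le_log (by nlinarith) ?_
    calc ((b - a) / 2 * w + 1) * ((d - c) / 2 * w + 1) ≤ w ^ 2 * w ^ 2 :=
          mul_le_mul e1 e2 (by linarith) (by positivity)
      _ = w ^ 4 := by ring
  exact (hφ.psi_mono (Real.log_nonneg (one_le_mul_of_one_le_of_one_le g1 g2)) h3).trans
    (hφ.psi_mul_le (by norm_num) (Real.log_nonneg hw))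

theorem integrableOn_entropyIntegrand (hφ : IsNFunction φ) (hZ : IsAdmissible φ Z u₀) (hK : 0 ≤ K)
    (hab : a ≤ b) (hcd : c ≤ d) (hrect : 0 < max (b - a) (d - c)) :
    IntegrableOn (entropyIntegrand φ Z u₀ K a b c d) (Set.Ioc 0 (gammaZero Z u₀ K a b c d)) := by
  rcases hK.eq_or_lt with rfl | hK0
  · simp [gammaZero]
  set γ := gammaZero Z u₀ K a b c d with hγ
  have hγ0 : 0 < γ := div_pos (by positivity) (hZ.map_inv_pos hrect)
  have hanti := antitoneOn_entropyIntegrand hφ hZ hK hab hcd hrect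
  obtain ⟨ε, hε, hint⟩ := hZ.integrable
  set R := (b - a) / 2 + (d - c) / 2 + 1 with hR
  have hR0 : 0 < R := by linarith
  have hZR : 0 < Z (R + u₀) := hZ.pos _ (by linarith)
  set ρ := min (min (2 * K / Z (R + u₀)) (2 * K * ε)) γ with hρ
  have hρ0 : 0 < ρ := lt_min (lt_min (by positivity) (by positivity)) hγ0
  have hρ1 : ρ ≤ 2 * K / Z (R + u₀) := (min_le_left _ _).trans (min_le_left _ _)
  have hρ2 : ρ ≤ 2 * K * ε := (min_le_left _ _).trans (min_le_right _ _)
  have hρ3 : ρ ≤ γ := min_le_right _ _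
  have hsmall : IntegrableOn (entropyIntegrand φ Z u₀ K a b c d) (Set.Ioo 0 ρ) := by
    have h1 := ((integrable_indicator_iff measurableSet_Ioo).2 hint).comp_div
      (R := 2 * K) (by positivity)
    have h2 := (h1.const_mul 4).integrableOn (s := Set.Ioo 0 ρ)
    have hsub : Set.Ioo 0 ρ ⊆ Set.Ioc 0 γ := fun s hs => ⟨hs.1, (hs.2.trans_le hρ3).le⟩
    refine Integrable.mono' h2 (aemeasurable_restrict_of_antitoneOn measurableSet_Ioo
      (hanti.mono hsub)).aestronglyMeasurable ?_
    refine (ae_restrict_mem measurableSet_Ioo).mono fun s hs => ?_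
    have hs' := hsub hs
    rw [Real.norm_of_nonneg (entropyIntegrand_nonneg hφ hZ hab hcd hrect hs'.1 hs'.2)]
    have hmem : s / (2 * K) ∈ Set.Ioo 0 ε := by
      refine ⟨div_pos hs.1 (by positivity), ?_⟩
      rw [div_lt_iff₀ (by positivity)]
      linarith [hs.2]
    rw [Set.indicator_of_mem hmem, one_div_div]
    exact entropyIntegrand_le hφ hab hcd (hZ.le_inverse_sub hR0 hs.1 (hs.2.le.trans hρ1))
  have hlarge : IntegrableOn (entropyIntegrand φ Z u₀ K a b c d) (Set.Icc (ρ / 2) γ) :=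
    (hanti.mono fun s hs => ⟨by linarith [hs.1], hs.2⟩).integrableOn_isCompact isCompact_Icc
  refine (hsmall.union hlarge).mono_set fun s hs => ?_
  rcases lt_or_ge s ρ with h | h
  · exact Or.inl ⟨hs.1, h⟩
  · exact Or.inr ⟨by linarith, hs.2⟩

theorem gammaZero_nonneg (hZ : IsAdmissible φ Z u₀) (hK : 0 ≤ K)
    (hrect : 0 < max (b - a) (d - c)) : 0 ≤ gammaZero Z u₀ K a b c d :=
  div_nonneg (by positivity) (hZ.map_inv_pos hrect).le

theorem intervalIntegrable_entropyIntegrand (hφ : IsNFunction φ) (hZ : IsAdmissible φ Z u₀)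
    (hK : 0 ≤ K) (hab : a ≤ b) (hcd : c ≤ d) (hrect : 0 < max (b - a) (d - c)) {s s' : ℝ}
    (hs : 0 ≤ s) (hss : s ≤ s') (h : s' ≤ gammaZero Z u₀ K a b c d) :
    IntervalIntegrable (entropyIntegrand φ Z u₀ K a b c d) volume s s' := by
  rw [intervalIntegrable_iff_integrableOn_Ioc_of_le hss]
  exact (integrableOn_entropyIntegrand hφ hZ hK hab hcd hrect).mono_set
    (Set.Ioc_subset_Ioc hs h)

/-- The integrand of the entropy integral is non-increasing, so on `[s, s']` it is at least its
value at `s'`. -/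
theorem mul_le_entropyIntegral_sub (hφ : IsNFunction φ) (hZ : IsAdmissible φ Z u₀)
    (hK : 0 ≤ K) (hab : a ≤ b) (hcd : c ≤ d) (hrect : 0 < max (b - a) (d - c)) {s s' m : ℝ}
    (hs : 0 ≤ s) (hss : s ≤ s') (h : s' ≤ gammaZero Z u₀ K a b c d)
    (hm : 0 < s' → m ≤ entropyIntegrand φ Z u₀ K a b c d s') :
    (s' - s) * m ≤ entropyIntegral φ Z u₀ K a b c d s' - entropyIntegral φ Z u₀ K a b c d s := by
  have hi := intervalIntegrable_entropyIntegrand hφ hZ hK hab hcd hrect hs hss h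
  have h0 := intervalIntegrable_entropyIntegrand hφ hZ hK hab hcd hrect le_rfl (hs.trans hss) h
  have h1 := intervalIntegrable_entropyIntegrand hφ hZ hK hab hcd hrect le_rfl hs (hss.trans h)
  unfold entropyIntegral
  rw [intervalIntegral.integral_interval_sub_left h0 h1, ← smul_eq_mul,
    ← intervalIntegral.integral_const]
  refine intervalIntegral.integral_mono_on_of_le_Ioo hss intervalIntegrable_const hi
    fun x hx => ?_
  have hx0 : 0 < x := hs.trans_lt hx.1
  have hs0 : 0 < s' := hx0.trans hx.2
  exact (hm hs0).trans (antitoneOn_entropyIntegrand hφ hZ hK hab hcd hrect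
    ⟨hx0, hx.2.le.trans h⟩ ⟨hs0, h⟩ hx.2.le)

/-- The logarithm of the bound for the number of points of the net of level `s`; a single point is
enough as soon as `s` exceeds `γ₀`. -/
noncomputable def netEntropy (Z : ℝ → ℝ) (u₀ K a b c d s : ℝ) : ℝ :=
  if s < gammaZero Z u₀ K a b c d then Real.log (coverBound Z u₀ K a b c d s) else 0

theorem netEntropy_nonneg (hZ : IsAdmissible φ Z u₀) (hab : a ≤ b) (hcd : c ≤ d)
    (hrect : 0 < max (b - a) (d - c)) {s : ℝ} (hs : 0 < s) :
    0 ≤ netEntropy Z u₀ K a b c d s := by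
  unfold netEntropy
  split_ifs with h
  · exact Real.log_nonneg (one_le_coverBound hZ hab hcd hrect hs h.le)
  · exact le_rfl

/-- The entropy sum of the chaining argument is a lower sum of the entropy integral over the
intervals `[Γ θ^{k+2}, Γ θ^{k+1}]`, up to the factor `1 / (θ (1 - θ))`. -/
theorem sum_psi_netEntropy_le (hφ : IsNFunction φ) (hZ : IsAdmissible φ Z u₀)
    (hK : 0 ≤ K) (hab : a ≤ b) (hcd : c ≤ d) (hrect : 0 < max (b - a) (d - c)) {Γ θ : ℝ}
    (hΓ : 0 < Γ) (hθ0 : 0 < θ) (hθ1 : θ < 1) (m : ℕ) :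
    ∑ k ∈ Finset.range m, Γ * θ ^ k * Psi φ (netEntropy Z u₀ K a b c d (Γ * θ ^ (k + 1))) ≤
      entropyIntegral φ Z u₀ K a b c d (min (θ * Γ) (gammaZero Z u₀ K a b c d)) /
        (θ * (1 - θ)) := by
  set γ := gammaZero Z u₀ K a b c d with hγ
  have hγ0 : 0 ≤ γ := gammaZero_nonneg hZ hK hrect
  have hc : 0 < θ * (1 - θ) := mul_pos hθ0 (by linarith)
  let E : ℕ → ℝ := fun k => entropyIntegral φ Z u₀ K a b c d (min (Γ * θ ^ (k + 1)) γ)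
  have hpos : ∀ k : ℕ, 0 < Γ * θ ^ k := fun k => by positivity
  have hle : ∀ k : ℕ, Γ * θ ^ (k + 1) ≤ Γ * θ ^ k := fun k => by
    rw [pow_succ, ← mul_assoc]
    exact mul_le_of_le_one_right (hpos k).le hθ1.le
  have hterm : ∀ k, Γ * θ ^ k * Psi φ (netEntropy Z u₀ K a b c d (Γ * θ ^ (k + 1))) *
      (θ * (1 - θ)) ≤ E k - E (k + 1) := by
    intro k
    have hmin : min (Γ * θ ^ (k + 1 + 1)) γ ≤ min (Γ * θ ^ (k + 1)) γ :=
      min_le_min_right _ (hle (k + 1))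
    have hmin0 : 0 ≤ min (Γ * θ ^ (k + 1 + 1)) γ := le_min (hpos _).le hγ0
    unfold netEntropy
    split_ifs with h
    · have h' := (hle (k + 1)).trans_lt h
      have := mul_le_entropyIntegral_sub hφ hZ hK hab hcd hrect
        (m := entropyIntegrand φ Z u₀ K a b c d (Γ * θ ^ (k + 1))) (hpos (k + 2)).le
        (hle (k + 1)) h.le fun _ => le_rfl
      simp only [E]
      rw [min_eq_left (show _ ≤ γ from h.le), min_eq_left (show _ ≤ γ from h'.le)]
      refine le_trans (le_of_eq ?_) this
      unfold entropyIntegrand coverBound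
      ring
    · have := mul_le_entropyIntegral_sub hφ hZ hK hab hcd hrect (m := 0) hmin0
        hmin (min_le_right _ _) fun h0 =>
          entropyIntegrand_nonneg hφ hZ hab hcd hrect h0 (min_le_right _ _)
      simpa [Psi, E] using this
  rw [le_div_iff₀ hc, Finset.sum_mul]
  refine (Finset.sum_le_sum fun k _ => hterm k).trans ?_
  rw [Finset.sum_range_sub']
  have hlast : 0 ≤ E m := by
    have := mul_le_entropyIntegral_sub hφ hZ hK hab hcd hrect (m := 0) le_rfl
      (le_min (hpos (m + 1)).le hγ0 : 0 ≤ min (Γ * θ ^ (m + 1)) γ) (min_le_right _ _) fun h0 =>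
          entropyIntegrand_nonneg hφ hZ hab hcd hrect h0 (min_le_right _ _)
    simpa [entropyIntegral, E] using this
  have h0 : E 0 = entropyIntegral φ Z u₀ K a b c d (min (θ * Γ) γ) := by
    simp [E, mul_comm]
  linarith

/-! ### Nets in the rectangle -/

theorem exists_net_Icc (hab : a ≤ b) {h : ℝ} (hh : 0 < h) :
    ∃ F : Finset (Set.Icc a b), F.Nonempty ∧ (F.card : ℝ) ≤ (b - a) / 2 * (1 / h) + 1 ∧
      ∀ x : Set.Icc a b, ∃ z ∈ F, |(x : ℝ) - z| ≤ h := by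
  have h2 : 0 < 2 * h := by positivity
  set n := ⌊(b - a) / (2 * h)⌋₊ with hn
  -- The centres of consecutive intervals of length `2 h`, the last one moved back into `[a, b]`.
  refine ⟨(Finset.range (n + 1)).image fun i : ℕ => Set.projIcc a b hab (a + (2 * i + 1) * h),
    ⟨_, Finset.mem_image_of_mem _ (Finset.mem_range.2 n.succ_pos)⟩, ?_, fun x => ?_⟩
  · have h1 : ((Finset.range (n + 1)).image fun i : ℕ =>
        Set.projIcc a b hab (a + (2 * i + 1) * h)).card ≤ n + 1 :=
      Finset.card_image_le.trans_eq (Finset.card_range _)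
    have h3 : (n : ℝ) ≤ (b - a) / (2 * h) := Nat.floor_le (div_nonneg (by linarith) h2.le)
    have h4 : (b - a) / (2 * h) = (b - a) / 2 * (1 / h) := by field_simp
    have h5 : (((Finset.range (n + 1)).image fun i : ℕ =>
        Set.projIcc a b hab (a + (2 * i + 1) * h)).card : ℝ) ≤ n + 1 := by exact_mod_cast h1
    linarith
  · obtain ⟨x, hxa, hxb⟩ := x
    set i := ⌊(x - a) / (2 * h)⌋₊ with hi
    have hin : i ≤ n := Nat.floor_le_floor (by gcongr)
    refine ⟨_, Finset.mem_image_of_mem _ (Finset.mem_range.2 (Nat.lt_succ_of_le hin)), ?_⟩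
    have h3 : (i : ℝ) ≤ (x - a) / (2 * h) := Nat.floor_le (div_nonneg (by linarith) h2.le)
    have h4 : (x - a) / (2 * h) < i + 1 := Nat.lt_floor_add_one _
    rw [le_div_iff₀ h2] at h3
    rw [div_lt_iff₀ h2] at h4
    rw [Set.coe_projIcc]
    simp only
    rcases le_total b (a + (2 * i + 1) * h) with h5 | h5
    · rw [min_eq_left h5, max_eq_right hab, abs_le]
      constructor <;> linarith
    · have : a ≤ a + (2 * i + 1) * h := by
        have : 0 ≤ (2 * (i : ℝ) + 1) * h := by positivity
        linarith
      rw [min_eq_right h5, max_eq_right this, abs_le]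
      constructor <;> linarith

/-- A net of the rectangle at the level `s`: between a point and its nearest point of the net, the
increment of the process has standard at most `s`. -/
theorem exists_net (hZ : IsAdmissible φ Z u₀) (hab : a ≤ b) (hcd : c ≤ d)
    (hrect : 0 < max (b - a) (d - c)) {s : ℝ} (hs : 0 < s) :
    ∃ (V : Finset (Set.Icc a b × Set.Icc c d)) (h : ℝ), 0 < h ∧ 2 * K / Z (1 / h + u₀) ≤ s ∧
      V.Nonempty ∧ (V.card : ℝ) ≤ Real.exp (netEntropy Z u₀ K a b c d s) ∧
      ∀ r : Set.Icc a b × Set.Icc c d, ∃ v ∈ V,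
        |(r.1 : ℝ) - v.1| ≤ h ∧ |(r.2 : ℝ) - v.2| ≤ h := by
  unfold netEntropy
  split_ifs with hlt
  · have hw := hZ.inverse_sub_pos hrect hs hlt.le
    have hspec := (hZ.map_inverse_add hrect hs hlt.le).2
    have hcov := one_le_coverBound hZ hab hcd hrect hs hlt.le
    have hinv : 1 / (1 / (inverse Z (2 * K / s) - u₀)) = inverse Z (2 * K / s) - u₀ :=
      one_div_one_div _
    have hh := one_div_pos.2 hw
    obtain ⟨F, hF, hFc, hFn⟩ := exists_net_Icc hab hh
    obtain ⟨F', hF', hFc', hFn'⟩ := exists_net_Icc hcd hh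
    refine ⟨F ×ˢ F', _, hh, ?_, hF.product hF', ?_, fun r => ?_⟩
    · rw [hinv, sub_add_cancel, hspec]
      have h1 : 0 < gammaZero Z u₀ K a b c d := hs.trans hlt
      have hK : 2 * K ≠ 0 := by
        intro h0
        rw [gammaZero, h0, zero_div] at h1
        exact lt_irrefl _ h1
      rw [div_div_cancel₀ hK]
    · rw [Real.exp_log (by linarith), Finset.card_product, Nat.cast_mul]
      rw [hinv] at hFc hFc'
      exact mul_le_mul hFc hFc' (Nat.cast_nonneg _) ((Nat.cast_nonneg _).trans hFc)
    · obtain ⟨z, hz, hz'⟩ := hFn r.1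
      obtain ⟨z₂, hz₂, hz₂'⟩ := hFn' r.2
      exact ⟨(z, z₂), Finset.mk_mem_product hz hz₂, hz', hz₂'⟩
  · have hdist : ∀ {p q : ℝ} (x y : Set.Icc p q), |(x : ℝ) - y| ≤ q - p := fun x y =>
      abs_le.2 ⟨by linarith [x.2.1, y.2.2], by linarith [x.2.2, y.2.1]⟩
    -- One point covers the rectangle with the radius `max (b - a) (d - c)`.
    refine ⟨{(⟨a, le_rfl, hab⟩, ⟨c, le_rfl, hcd⟩)}, max (b - a) (d - c), hrect, not_lt.1 hlt,
      Finset.singleton_nonempty _, by simp, fun r => ⟨_, Finset.mem_singleton_self _,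
        (hdist _ _).trans (le_max_left _ _), (hdist _ _).trans (le_max_right _ _)⟩⟩

end Entropy

/-! ### The Legendre transform of the bound -/

theorem le_two_mul_exp_neg_youngFenchel {φ : ℝ → ℝ} (hφ : IsNFunction φ) {v : ℝ} (hv : 0 ≤ v)
    {q : ℝ≥0∞} (hq1 : q ≤ 1)
    (hq : ∀ x : ℝ, 0 < x → q ≤ ENNReal.ofReal (2 * Real.exp (φ x - v * x))) :
    q ≤ ENNReal.ofReal (2 * Real.exp (-youngFenchel φ v)) := by
  -- Each `v x - φ x` is at most `-log (q / 2)`; for `x ≤ 0` this holds because `q ≤ 1`.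
  rcases eq_or_ne q 0 with rfl | hq0
  · exact zero_le
  have hqt : q ≠ ⊤ := (hq1.trans_lt ENNReal.one_lt_top).ne
  rw [ENNReal.le_ofReal_iff_toReal_le hqt (by positivity)]
  have hpos : 0 < q.toReal := ENNReal.toReal_pos hq0 hqt
  have hall : ∀ x : ℝ, q.toReal ≤ 2 * Real.exp (-(v * x - φ x)) := by
    intro x
    rcases le_or_gt x 0 with hx | hx
    · have h1 : 0 ≤ -(v * x - φ x) := by
        have := hφ.nonneg x
        nlinarith
      have h2 := Real.one_le_exp h1
      have h3 := ENNReal.toReal_mono ENNReal.one_ne_top hq1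
      rw [ENNReal.toReal_one] at h3
      linarith
    · rw [neg_sub]
      exact (ENNReal.le_ofReal_iff_toReal_le hqt (by positivity)).1 (hq x hx)
  have hlog : youngFenchel φ v ≤ -Real.log (q.toReal / 2) := by
    refine ciSup_le fun x => ?_
    have h1 : q.toReal / 2 ≤ Real.exp (-(v * x - φ x)) := by linarith [hall x]
    have h2 := (Real.log_le_iff_le_exp (by positivity)).2 h1
    linarith
  have h3 := (Real.log_le_iff_le_exp (show 0 < q.toReal / 2 by positivity)).1
    (show Real.log (q.toReal / 2) ≤ -youngFenchel φ v by linarith)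
  linarith

/-! ### The random field `U` on the rectangle -/

section Solution

variable {Ω : Type*} [MeasurableSpace Ω] {P : Measure Ω} {φ Z : ℝ → ℝ} {u₀ : ℝ}
  {y : ℝ → Ω → ℝ} {Cy : ℝ} {κ : ℝ → ℝ} {N : ℕ} {α : ℕ → ℝ}

theorem lintegral_exp_value_le (hφ : IsNFunction φ) (hy : IsStrictlySub φ P y Cy)
    (hvar : totalVariation (covFun P y) < ⊤) (hκ : κ = Real.cos ∨ κ = Real.sin) {t x : ℝ}
    {X : Ω → ℝ} (hX : HasMSIntegral P y (waveKernel κ N α t x) X) (l : ℝ) :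
    ∫⁻ ω, ENNReal.ofReal (Real.exp (l * X ω)) ∂P ≤
      ENNReal.ofReal (Real.exp (φ (l * bigGamma Cy (covFun P y)))) := by
  have hy2 : ∀ t, MemLp (y t) 2 P := fun t => (hy.memSub t).memLp_two
  refine hy.lintegral_exp_le hφ (hX.memL2Span hy2) ?_ l
  refine mul_le_mul_of_nonneg_left ?_ hy.const_nonneg
  have hone : (fun _ _ : ℝ => ENNReal.ofReal ((1 : ℝ) * 1)) = fun _ _ => 1 := by simp
  have := hX.toReal_eLpNorm_le (w := fun _ => 1) hy2 hvar zero_le_one continuous_const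
    (fun _ => zero_le_one) (fun l => ?_) (by rw [hone]; exact hvar)
  · rwa [hone, one_mul] at this
  · rw [one_mul]
    rcases hκ with rfl | rfl
    exacts [Real.abs_cos_le_one _, Real.abs_sin_le_one _]

theorem lintegral_exp_increment_le (hφ : IsNFunction φ) (hZ : IsAdmissible φ Z u₀)
    (hy : IsStrictlySub φ P y Cy) (hvar : totalVariation (covFun P y) < ⊤)
    (hκ : κ = Real.cos ∨ κ = Real.sin) (hCZ : CZsq Z u₀ N α (covFun P y) < ⊤)
    {t x t' x' h s : ℝ} {X X' : Ω → ℝ} (hX : HasMSIntegral P y (waveKernel κ N α t x) X)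
    (hX' : HasMSIntegral P y (waveKernel κ N α t' x') X') (hh : 0 < h) (ht : |t - t'| ≤ h)
    (hx : |x - x'| ≤ h) (hs : 2 * (Cy * CZ Z u₀ N α (covFun P y)) / Z (1 / h + u₀) ≤ s) (l : ℝ) :
    ∫⁻ ω, ENNReal.ofReal (Real.exp (l * (X - X') ω)) ∂P ≤
      ENNReal.ofReal (Real.exp (φ (l * s))) := by
  have hy2 : ∀ t, MemLp (y t) 2 P := fun t => (hy.memSub t).memLp_two
  have hD := hX.sub hy2 hX'
  refine hy.lintegral_exp_le hφ (hD.memL2Span hy2) (le_trans ?_ hs) l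
  have := hD.toReal_eLpNorm_le (w := weight Z u₀ N α) (c := 2 / Z (1 / h + u₀)) hy2 hvar
    (div_nonneg zero_le_two (hZ.map_inv_pos hh).le) (hZ.continuous_weight N α)
    (hZ.weight_nonneg N α) (fun l => hZ.abs_sub_waveKernel_le hκ N α hh ht hx l) hCZ
  refine (mul_le_mul_of_nonneg_left this hy.const_nonneg).trans (le_of_eq ?_)
  change Cy * (2 / Z (1 / h + u₀) * CZ Z u₀ N α (covFun P y)) = _
  ring

end Solution

end PhiSubGaussian

theorem mainTheorem1 {Ω : Type*} [MeasurableSpace Ω] (P : Measure Ω) [IsProbabilityMeasure P]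
    (φ : ℝ → ℝ) (hφ : IsNFunction φ) (hQ : ConditionQ φ)
    (Z : ℝ → ℝ) (u₀ : ℝ) (hZ : IsAdmissible φ Z u₀)
    (y : ℝ → Ω → ℝ) (Cy : ℝ) (hy : IsStrictlySub φ P y Cy)
    (hvar : totalVariation (covFun P y) < ⊤)
    (κ : ℝ → ℝ) (hκ : κ = Real.cos ∨ κ = Real.sin)
    (N : ℕ) (α : ℕ → ℝ)
    (a b c d : ℝ) (hab : a ≤ b) (hcd : c ≤ d) (hrect : 0 < max (b - a) (d - c))
    (U : ℝ → ℝ → Ω → ℝ)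
    (hU : ∀ t ∈ Set.Icc a b, ∀ x ∈ Set.Icc c d,
      HasMSIntegral P y (waveKernel κ N α t x) (U t x))
    (hcont : ∀ᵐ ω ∂P,
      ContinuousOn (fun r : ℝ × ℝ => U r.1 r.2 ω) (Set.Icc a b ×ˢ Set.Icc c d))
    (hCZ : CZsq Z u₀ N α (covFun P y) < ⊤)
    (K Γ γ₀ : ℝ) (hK : K = Cy * CZ Z u₀ N α (covFun P y))
    (hΓ : Γ = bigGamma Cy (covFun P y)) (hγ₀ : γ₀ = gammaZero Z u₀ K a b c d)
    (θ : ℝ) (hθ : θ ∈ Set.Ioo (0 : ℝ) 1) :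
    IntervalIntegrable (entropyIntegrand φ Z u₀ K a b c d) volume 0 (min (θ * Γ) γ₀) ∧
    ∀ u : ℝ, 2 * entropyIntegral φ Z u₀ K a b c d (min (θ * Γ) γ₀) / (θ * (1 - θ)) < u →
      P {ω | ENNReal.ofReal u < ⨆ t ∈ Set.Icc a b, ⨆ x ∈ Set.Icc c d, ‖U t x ω‖ₑ} ≤
        ENNReal.ofReal (2 * Real.exp (-youngFenchel φ
          (1 / Γ * (u * (1 - θ) -
            2 / θ * entropyIntegral φ Z u₀ K a b c d (min (θ * Γ) γ₀))))) := by
  obtain ⟨hθ0, hθ1⟩ := hθ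
  have hK0 : 0 ≤ K := by
    rw [hK]; exact mul_nonneg hy.const_nonneg (Real.sqrt_nonneg _)
  have hΓ0 : 0 ≤ Γ := by
    rw [hΓ]; exact mul_nonneg hy.const_nonneg (Real.sqrt_nonneg _)
  have hγ₀0 : 0 ≤ γ₀ := by rw [hγ₀]; exact gammaZero_nonneg hZ hK0 hrect
  refine ⟨intervalIntegrable_entropyIntegrand hφ hZ hK0 hab hcd hrect le_rfl
    (le_min (by positivity) hγ₀0) (by rw [← hγ₀]; exact min_le_right _ _), fun u hu => ?_⟩
  set E := entropyIntegral φ Z u₀ K a b c d (min (θ * Γ) γ₀) with hE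
  have h1θ : 0 < 1 - θ := by linarith
  rcases hΓ0.eq_or_lt with hΓz | hΓp
  · -- With `Γ = 0` the bound reads `P _ ≤ 2`.
    rw [← hΓz, div_zero, zero_mul, hφ.youngFenchel_zero]
    refine prob_le_one.trans ?_
    simp
  set T := Set.Icc a b × Set.Icc c d
  let X : T → Ω → ℝ := fun r => U r.1 r.2
  have hX : ∀ r : T, HasMSIntegral P y (waveKernel κ N α r.1 r.2) (X r) := fun r =>
    hU _ r.1.2 _ r.2.2
  have hXm : ∀ r, AEMeasurable (X r) P := fun r => (hX r).1.1.aemeasurable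
  have hlev : ∀ k : ℕ, 0 < Γ * θ ^ k := fun k => by positivity
  choose V h hh hhs hVne hVcard hVnet using fun k : ℕ =>
    exists_net (K := K) hZ hab hcd hrect (hlev (k + 1))
  choose π hπV hπ1 hπ2 using hVnet
  have hlink : ∀ k, ∀ s ∈ V k, ∀ l : ℝ,
      ∫⁻ ω, ENNReal.ofReal (Real.exp (l * link X π k s ω)) ∂P ≤
        ENNReal.ofReal (Real.exp (φ (l * (Γ * θ ^ k)))) := by
    intro k s _ l
    cases k with
    | zero =>
      rw [pow_zero, mul_one, hΓ]
      exact lintegral_exp_value_le hφ hy hvar hκ (hX s) l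
    | succ k =>
      exact lintegral_exp_increment_le hφ hZ hy hvar hκ hCZ (hX s) (hX (π k s)) (hh k)
        (hπ1 k s) (hπ2 k s) (by rw [← hK]; exact hhs k) l
  -- The chaining bound for the points of the nets.
  have hchain : ∀ x : ℝ, 0 < x → P {ω | ∃ k, ∃ s ∈ V k, u < |X s ω|} ≤
      ENNReal.ofReal (2 * Real.exp (φ x - (1 / Γ * (u * (1 - θ) - 2 / θ * E)) * x)) := by
    intro x hx
    have hl : 0 < x * (1 - θ) / Γ := by positivity
    have := measure_exists_lt_abs_le (l := x * (1 - θ) / Γ) (x := x) (B := E / (θ * (1 - θ)))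
      (σ := fun k => Γ * θ ^ k)
      (H := fun k => netEntropy Z u₀ K a b c d (Γ * θ ^ (k + 1))) hφ hXm hVne
      (fun k s _ => hπV k s) hlev
      (fun k => netEntropy_nonneg hZ hab hcd hrect (hlev (k + 1))) hVcard hlink hl hx ?_ ?_ u
    · refine this.trans_eq ?_
      congr 3
      field_simp
      ring
    · intro m
      rw [← Finset.mul_sum]
      have hgeom := mul_neg_geom_sum θ m
      calc x * (1 - θ) / Γ * (Γ * ∑ i ∈ Finset.range m, θ ^ i)
          = x * ((1 - θ) * ∑ i ∈ Finset.range m, θ ^ i) := by field_simp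
        _ ≤ x * 1 := by
          rw [hgeom]
          gcongr
          linarith [pow_pos hθ0 m]
        _ = x := mul_one x
    · intro m
      rw [hE, hγ₀]
      exact sum_psi_netEntropy_le hφ hZ hK0 hab hcd hrect hΓp hθ0 hθ1 m
  have hcX : ∀ᵐ ω ∂P, Continuous fun r : T => X r ω := by
    filter_upwards [hcont] with ω hω
    exact hω.comp_continuous (f := fun r : T => ((r.1 : ℝ), (r.2 : ℝ)))
      ((continuous_subtype_val.comp continuous_fst).prodMk
        (continuous_subtype_val.comp continuous_snd)) fun r => ⟨r.1.2, r.2.2⟩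
  -- By continuity the supremum exceeds `u` only if some value on the nets does.
  have hdense : ∀ᵐ ω ∂P, (∃ r : T, u < |X r ω|) → ∃ k, ∃ s ∈ V k, u < |X s ω| := by
    rcases hK0.eq_or_lt with hKz | hKp
    · -- With `K = 0` all the values coincide almost surely.
      obtain ⟨v, hv⟩ := hVne 0
      have : Nonempty T := ⟨v⟩
      have heq : ∀ r : T, ∀ᵐ ω ∂P, (X r - X v) ω = 0 := fun r => by
        refine ae_eq_zero_of_lintegral_exp_le_one ((hXm r).sub (hXm v)) fun l => ?_
        have hpos : 0 < max |(r.1 : ℝ) - v.1| |(r.2 : ℝ) - v.2| + 1 := by positivity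
        have := lintegral_exp_increment_le (s := 0) hφ hZ hy hvar hκ hCZ (hX r) (hX v) hpos
          ((le_max_left _ _).trans (le_add_of_nonneg_right zero_le_one))
          ((le_max_right _ _).trans (le_add_of_nonneg_right zero_le_one))
          (by rw [← hK, ← hKz, mul_zero, zero_div]) l
        simpa [hφ.map_zero] using this
      have heq' := ae_all_iff.2 fun n : ℕ => heq (TopologicalSpace.denseSeq T n)
      filter_upwards [hcX, heq'] with ω hω hn
      rintro ⟨r, hr⟩
      have hopen : IsOpen {r : T | u < |X r ω|} := isOpen_lt continuous_const hω.abs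
      obtain ⟨_, hs, n, rfl⟩ :=
        (TopologicalSpace.denseRange_denseSeq T).inter_open_nonempty _ hopen ⟨r, hr⟩
      refine ⟨0, v, hv, ?_⟩
      have h0 : X (TopologicalSpace.denseSeq T n) ω = X v ω := sub_eq_zero.1 (hn n)
      rw [← h0]
      exact hs
    · filter_upwards [hcX] with ω hω
      rintro ⟨r, hr⟩
      have hopen : IsOpen {r : T | u < |X r ω|} := isOpen_lt continuous_const hω.abs
      obtain ⟨η, hη, hball⟩ := Metric.isOpen_iff.1 hopen r hr
      have hZη : 0 < Z (1 / (η / 2) + u₀) := hZ.map_inv_pos (half_pos hη)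
      -- The radii of the nets tend to `0` because their levels do.
      obtain ⟨k, hk⟩ : ∃ k : ℕ, Γ * θ ^ (k + 1) < 2 * K / Z (1 / (η / 2) + u₀) := by
        have hlim : Tendsto (fun k : ℕ => Γ * θ ^ (k + 1)) atTop (𝓝 (Γ * 0)) :=
          ((tendsto_pow_atTop_nhds_zero_of_lt_one hθ0.le hθ1).comp
            (tendsto_add_atTop_nat 1)).const_mul Γ
        rw [mul_zero] at hlim
        exact (hlim.eventually_lt_const (by positivity)).exists
      have hhη : h k < η := by
        by_contra hcon
        have h1 : 1 / h k ≤ 1 / (η / 2) :=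
          one_div_le_one_div_of_le (half_pos hη) (by linarith)
        have h2 := one_div_pos.2 (hh k)
        have h3 : Z (1 / h k + u₀) ≤ Z (1 / (η / 2) + u₀) :=
          hZ.mono (by linarith [hZ.const_nonneg]) (by linarith)
        have h4 : 2 * K / Z (1 / (η / 2) + u₀) ≤ 2 * K / Z (1 / h k + u₀) :=
          div_le_div_of_nonneg_left (by positivity) (hZ.map_inv_pos (hh k)) h3
        linarith [hhs k]
      refine ⟨k, π k r, hπV k r, hball ?_⟩
      rw [Metric.mem_ball, dist_comm, Prod.dist_eq]
      exact max_lt ((hπ1 k r).trans_lt hhη) ((hπ2 k r).trans_lt hhη)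
  have hsup : P {ω | ENNReal.ofReal u < ⨆ t ∈ Set.Icc a b, ⨆ x ∈ Set.Icc c d, ‖U t x ω‖ₑ} ≤
      P {ω | ∃ k, ∃ s ∈ V k, u < |X s ω|} := by
    refine measure_mono_ae ?_
    filter_upwards [hdense] with ω hω hmem
    have hmem : ENNReal.ofReal u < ⨆ t ∈ Set.Icc a b, ⨆ x ∈ Set.Icc c d, ‖U t x ω‖ₑ := hmem
    simp only [lt_iSup_iff] at hmem
    obtain ⟨t, ht, x, hx, htx⟩ := hmem
    rw [Real.enorm_eq_ofReal_abs] at htx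
    exact hω ⟨(⟨t, ht⟩, ⟨x, hx⟩), (ENNReal.ofReal_lt_ofReal_iff'.1 htx).1⟩
  refine le_two_mul_exp_neg_youngFenchel hφ ?_ prob_le_one fun x hx => hsup.trans (hchain x hx)
  have h2 : 2 / θ * E ≤ u * (1 - θ) := by
    rw [div_lt_iff₀ (by positivity)] at hu
    rw [div_mul_eq_mul_div, div_le_iff₀ hθ0]
    linarith
  have h3 : 0 ≤ u * (1 - θ) - 2 / θ * E := by linarith
  positivity
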